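/- For $n\ge 1$ let $A\subseteq\mathbb{F}_2^n$ be a random subset that contains each element of $\mathbb{F}_2^n$ with probability $\tfrac12$, independently of the other elements. The random Cayley graph on $\mathbb{F}_2^n$ is the graph with vertex set $\mathbb{F}_2^n$ in which two vertices $x\neq y$ are adjacent if and only if $x+y\in A$. Let $\omega_n$ denote its clique number, that is, the number of vertices of its largest complete subgraph. Then for every $\epsilon>0$, $$\lim_{n\to\infty}\mathbb{P}\left(\tfrac12\, n\log_2 n<\omega_n<(1+\epsilon)\,n\log_2 n\right)=1.$$ -/

import Mathlib

open Filter Topology MeasureTheory ProbabilityTheory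

/-- The Cayley sum graph on a commutative additive group `G` generated by `A ⊆ G`: distinct
vertices `x`, `y` are joined if and only if `x + y ∈ A`. On `𝔽₂ⁿ` one has `x + y = x - y`, so
there it is also the Cayley graph generated by `A`. -/
def cayleySumGraph {G : Type*} [AddCommGroup G] (A : Set G) : SimpleGraph G where
  Adj x y := x ≠ y ∧ x + y ∈ A
  symm := ⟨fun x y h => ⟨h.1.symm, by rw [add_comm]; exact h.2⟩⟩
  loopless := ⟨fun _ h => h.1 rfl⟩

/-- `A` is a random subset of `G`, defined on the probability space `(Ω, P)`, that contains each
element of `G` with probability `1/2`, independently of the other elements. -/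
structure IsRandomHalfSubset {Ω : Type*} [MeasurableSpace Ω] (P : Measure Ω) {G : Type*}
    (A : Ω → Set G) : Prop where
  measurableSet_mem : ∀ x : G, MeasurableSet {ω | x ∈ A ω}
  prob_mem : ∀ x : G, P {ω | x ∈ A ω} = 1 / 2
  indep : iIndepSet (fun x : G => {ω | x ∈ A ω}) P

/-! Upper bound. If a clique contains a `k`-set `X`, with `k` about `(1 + ε) n log₂ n`, then every
nonzero element of `X + X` lies in `A`. For a fixed `X` this has probability at most `2 ^ (1 - |X +
X|)`. There may be as many as `2 ^ (n k)` sets `X`, so a union bound over all of them works only if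
`X + X` has more than `n k` elements. Otherwise the union runs over large subsets of `X + X` that
have short descriptions. A maximal robustly expanding `Y ⊆ X` makes `X` almost closed under addition
modulo `Y` (`exists_robust_expanding_subset`). Hence most of `X` lies in a subspace `U` of dimension
at most about `|Y| + log₂ k` (`exists_submodule_of_almost_closed`), and a set `R ⊆ X` with disjoint
translates of subsets of `U` accounts for the rest (`exists_disjoint_translates`). Put `s = |Y ∪ R|`
and `c = θ² / 4` for a small multiple `θ` of `ε`. If `s` is bounded, two sets `A`, `B` of size about
`√k` inside `U` have a sumset of almost `k` elements. Naming them costs about `n log₂ k` bits,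
roughly `k / (1 + ε)`, which is where the constant `1 + ε` enters. If `s` is intermediate, almost
all of `X` is a subset `Z` of `A + B + Y` with `A`, `B` much smaller than `X`. The set `(Y ∪ R) + Z`
has at least `c k s` elements and costs at most about half that many bits. If `s ≥ 2 n / c`, then `X
+ X` itself has at least `2 n k` elements. `exists_code_sumset_subset` contains this trichotomy.
Lower bound. A subspace of dimension `d` whose nonzero elements lie in `A` is a clique of size `2 ^
d`. The second moment method is applied to the graphs of linear maps `𝔽₂ᵈ → 𝔽₂ⁿ⁻ᵈ`. Two graphs meet
in a copy of the kernel of the difference, so the second moment is an average of `2 ^ (|ker N| - 1)`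
over all linear `N` (`sum_two_pow_card_ker_le`). The largest `d` with `2 ^ d ≤ n log₂ n` still
works, and rounding down to a power of two costs the factor `1 / 2`. -/

/-! ### Sumset structure of a finite set over `𝔽₂`. -/

section Combinatorics

open scoped Pointwise Classical

/-- Maximality argument: a subset `Y` of `X` whose sumsets with all large subsets of `X` are large,
and whose sumset with `X` captures almost all of each translate of `X`. -/
theorem exists_robust_expanding_subset {V : Type*} [AddCommGroup V] (X : Finset V)
    {δ : ℝ} (hδ : 0 ≤ δ) :
    ∃ Y ⊆ X, (∀ Z ⊆ X, ((X \ Z).card : ℝ) ≤ δ * X.card →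
        δ * X.card * Y.card ≤ ((Y + Z).card : ℝ)) ∧
      ∀ x ∈ X, ((X.filter fun z => x + z ∉ Y + X).card : ℝ) ≤ 2 * δ * X.card := by
  set p : Finset V → Prop := fun Y => ∀ Z ⊆ X, ((X \ Z).card : ℝ) ≤ δ * X.card →
        δ * X.card * Y.card ≤ ((Y + Z).card : ℝ) with hp
  obtain ⟨Y, hY, hmax⟩ := Finset.exists_max_image (X.powerset.filter p) Finset.card
    ⟨∅, by simp [hp]⟩
  simp only [Finset.mem_filter, Finset.mem_powerset] at hY hmax
  refine ⟨Y, hY.1, hY.2, fun x hx => ?_⟩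
  by_contra! hlt
  have hxY : x ∉ Y := by
    intro hxY
    have : (X.filter fun z => x + z ∉ Y + X) = ∅ := by
      ext z
      simp only [Finset.mem_filter, Finset.notMem_empty, iff_false, not_and, not_not]
      exact fun hz => Finset.add_mem_add hxY hz
    rw [this] at hlt
    have : 0 ≤ 2 * δ * (X.card : ℝ) := by positivity
    simp at hlt
    linarith
  have hnp : ¬ p (insert x Y) := by
    intro h
    have := hmax (insert x Y) ⟨Finset.insert_subset hx hY.1, h⟩
    rw [Finset.card_insert_of_notMem hxY] at this
    omega
  simp only [hp, not_forall, not_le] at hnp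
  obtain ⟨Z, hZX, hZ, hlt2⟩ := hnp
  have h1 := hY.2 Z hZX hZ
  -- `F` counts the new sums gained by adding `x` to `Y`. As `Y` satisfies `p` and `insert x Y`
  -- fails it at `Z`, fewer than `δ |X|` sums are new, and at most `δ |X|` further elements lie
  -- outside `Z`. Together they contradict the `2 δ |X|` in `hlt`.
  set F := Z.filter fun z => x + z ∉ Y + Z with hF
  have h2 : (X.filter fun z => x + z ∉ Y + X) ⊆ (X \ Z) ∪ F := by
    intro z hz
    simp only [Finset.mem_filter, Finset.mem_union, Finset.mem_sdiff, hF] at hz ⊢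
    by_cases hzZ : z ∈ Z
    · exact Or.inr ⟨hzZ, fun h => hz.2 (Finset.add_subset_add_left hZX h)⟩
    · exact Or.inl ⟨hz.1, hzZ⟩
  have h3 : (F.image (x + ·)) ∪ (Y + Z) ⊆ insert x Y + Z := by
    intro t ht
    rw [Finset.mem_union, Finset.mem_image] at ht
    rcases ht with ⟨z, hz, rfl⟩ | ht
    · exact Finset.add_mem_add (Finset.mem_insert_self _ _) (Finset.mem_filter.1 hz).1
    · exact Finset.add_subset_add_right (Finset.subset_insert _ _) ht
  have h4 : Disjoint (F.image (x + ·)) (Y + Z) := by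
    rw [Finset.disjoint_left]
    intro t ht
    rw [Finset.mem_image] at ht
    obtain ⟨z, hz, rfl⟩ := ht
    exact (Finset.mem_filter.1 hz).2
  have h5 := Finset.card_le_card h3
  rw [Finset.card_union_of_disjoint h4, Finset.card_image_of_injective _ (add_right_injective x)]
    at h5
  have h6 := (Finset.card_le_card h2).trans (Finset.card_union_le _ _)
  rw [Finset.card_insert_of_notMem hxY] at hlt2
  have h5' : (F.card : ℝ) + (Y + Z).card ≤ (insert x Y + Z).card := by exact_mod_cast h5
  have h6' : ((X.filter fun z => x + z ∉ Y + X).card : ℝ) ≤ (X \ Z).card + F.card := by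
    exact_mod_cast h6
  push_cast at hlt2
  nlinarith

/-- Greedy choice of few elements of `X` that hit almost all of the targets in `T`. -/
theorem exists_hitting_set {α β : Type*} (T : Finset α) (X : Finset β) (r : α → β → Prop)
    {ρ : ℝ} (hρ1 : ρ ≤ 1) (hX : X.Nonempty)
    (h : ∀ t ∈ T, ρ * X.card ≤ ((X.filter fun b => r t b).card : ℝ)) (m : ℕ) :
    ∃ B ⊆ X, B.card ≤ m ∧
      ((T.filter fun t => ∀ b ∈ B, ¬ r t b).card : ℝ) ≤ (1 - ρ) ^ m * T.card := by
  induction m with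
  | zero => exact ⟨∅, by simp, by simp, by simp⟩
  | succ m ih =>
    obtain ⟨B, hBX, hBm, hB⟩ := ih
    set T' := T.filter fun t => ∀ b ∈ B, ¬ r t b with hT'
    -- Averaging: each unhit target is hit by a proportion `ρ` of `X`, so some `b` hits a proportion
    -- `ρ` of the unhit targets.
    have key : ∃ b ∈ X, ρ * T'.card ≤ ((T'.filter fun t => r t b).card : ℝ) := by
      by_contra! hc
      have h1 : ∑ b ∈ X, ((T'.filter fun t => r t b).card : ℝ) < ∑ b ∈ X, ρ * T'.card :=
        Finset.sum_lt_sum_of_nonempty hX hc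
      have h2 : ∑ b ∈ X, ((T'.filter fun t => r t b).card : ℝ)
          = ∑ t ∈ T', ((X.filter fun b => r t b).card : ℝ) := by
        exact_mod_cast (Finset.sum_card_bipartiteAbove_eq_sum_card_bipartiteBelow
          (s := T') (t := X) r).symm
      have h3 : ∑ t ∈ T', ρ * (X.card : ℝ) ≤ ∑ t ∈ T', ((X.filter fun b => r t b).card : ℝ) :=
        Finset.sum_le_sum fun t ht => h t (Finset.mem_filter.1 ht).1
      simp only [Finset.sum_const, nsmul_eq_mul] at h1 h3
      rw [h2] at h1
      nlinarith
    obtain ⟨b, hbX, hb⟩ := key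
    refine ⟨insert b B, Finset.insert_subset hbX hBX,
      (Finset.card_insert_le _ _).trans (by omega), ?_⟩
    have h4 : (T.filter fun t => ∀ b' ∈ insert b B, ¬ r t b') = T'.filter fun t => ¬ r t b := by
      ext t
      simp only [Finset.mem_filter, Finset.mem_insert, forall_eq_or_imp, hT']
      tauto
    rw [h4]
    have h5 := Finset.card_filter_add_card_filter_not (s := T') (fun t => r t b)
    have h5' : ((T'.filter fun t => r t b).card : ℝ) + (T'.filter fun t => ¬ r t b).card
        = T'.card := by exact_mod_cast h5
    calc ((T'.filter fun t => ¬ r t b).card : ℝ) ≤ (1 - ρ) * T'.card := by linarith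
      _ ≤ (1 - ρ) * ((1 - ρ) ^ m * T.card) := by
        apply mul_le_mul_of_nonneg_left hB (by linarith)
      _ = (1 - ρ) ^ (m + 1) * T.card := by ring

/-- If `X` is almost closed under addition modulo `Y`, then most of `X` lies in a subspace of
small dimension. -/
theorem exists_submodule_of_almost_closed {V : Type*} [AddCommGroup V] [Module (ZMod 2) V]
    [Fintype V] (X Y : Finset V) (hYX : Y ⊆ X) (hY : Y.Nonempty) {θ : ℝ} (hθ0 : 0 < θ)
    (hθ1 : θ < 1)
    (hst : ∀ x ∈ X, ((X.filter fun z => x + z ∉ Y + X).card : ℝ) ≤ θ ^ 2 * X.card) :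
    ∃ (U : Submodule (ZMod 2) V) (j : ℕ), (∀ y ∈ Y, y ∈ U) ∧
      Module.finrank (ZMod 2) U ≤ Y.card + j ∧ (2 - θ) ^ j ≤ (X.card : ℝ) ∧
      (1 - θ) * X.card ≤ ((X.filter fun x => x ∈ U).card : ℝ) := by
  have hself : ∀ v : V, v + v = 0 := fun v => ZModModule.add_self v
  set W : Submodule (ZMod 2) V := Submodule.span (ZMod 2) (Y : Set V) with hW
  have hYW : ∀ y ∈ Y, y ∈ W := fun y hy => Submodule.subset_span hy
  set w : ℕ := (Finset.univ.filter fun v : V => v ∈ W).card with hw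
  have hwpos : 0 < w := Finset.card_pos.2 ⟨0, by simp⟩
  -- `Q` is `X + W`, a union of cosets of `W`. Counting in `Q` instead of `X` makes almost closure
  -- modulo `Y` an honest closure property, since `Y + X ⊆ Q`.
  set Q : Finset V := Finset.univ.filter fun v => ∃ x ∈ X, v + x ∈ W with hQ
  have hQcard : Q.card ≤ X.card * w := by
    have : Q ⊆ X + (Finset.univ.filter fun v : V => v ∈ W) := by
      intro v hv
      obtain ⟨x, hx, hvx⟩ := (Finset.mem_filter.1 hv).2
      refine Finset.mem_add.2 ⟨x, hx, v + x, by simpa using hvx, ?_⟩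
      rw [add_comm v x, ← add_assoc, hself, zero_add]
    exact (Finset.card_le_card this).trans Finset.card_add_le
  -- Each new dimension must multiply `|Q ∩ U|` by at least `2 - θ`. Since `|Q| ≤ |X| w`, this
  -- stops, and the last possible `U` is the one sought.
  set p : ℕ → Prop := fun j => ∃ U : Submodule (ZMod 2) V, W ≤ U ∧
    Module.finrank (ZMod 2) U ≤ Y.card + j ∧
    (2 - θ) ^ j * w ≤ ((Q.filter fun v => v ∈ U).card : ℝ) with hp
  have hp0 : p 0 := by
    refine ⟨W, le_rfl, ?_, ?_⟩
    · rw [add_zero]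
      exact finrank_span_finset_le_card (R := ZMod 2) Y
    · simp only [pow_zero, one_mul, Nat.cast_le, hw]
      apply Finset.card_le_card
      intro v hv
      obtain ⟨y, hy⟩ := hY
      simp only [Finset.mem_filter, Finset.mem_univ, true_and, hQ] at hv ⊢
      exact ⟨⟨y, hYX hy, W.add_mem hv (hYW y hy)⟩, hv⟩
  have hbound : ∀ j, p j → (2 - θ) ^ j ≤ (X.card : ℝ) := by
    rintro j ⟨U, -, -, h⟩
    have h1 : ((Q.filter fun v => v ∈ U).card : ℝ) ≤ X.card * w := by
      exact_mod_cast (Finset.card_le_card (Finset.filter_subset _ _)).trans hQcard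
    have hw' : (0 : ℝ) < w := by exact_mod_cast hwpos
    exact le_of_mul_le_mul_right (h.trans h1) hw'
  obtain ⟨j, hj, hj'⟩ : ∃ j, p j ∧ ¬ p (j + 1) := by
    by_contra! hc
    have hall : ∀ j, p j := fun j => by
      induction j with
      | zero => exact hp0
      | succ j ih => exact hc j ih
    obtain ⟨j, hj⟩ := pow_unbounded_of_one_lt (X.card : ℝ) (show 1 < 2 - θ by linarith)
    exact absurd (hbound j (hall j)) (not_le.2 hj)
  obtain ⟨U, hWU, hUr, hUQ⟩ := hj
  refine ⟨U, j, fun y hy => hWU (hYW y hy), hUr, hbound j ⟨U, hWU, hUr, hUQ⟩, ?_⟩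
  by_contra! hlt
  apply hj'
  set D := X.filter fun x => x ∉ U with hD
  have hDcard : θ * X.card < D.card := by
    have := Finset.card_filter_add_card_filter_not (s := X) (fun x => x ∈ U)
    have h' : ((X.filter fun x => x ∈ U).card : ℝ) + D.card = X.card := by exact_mod_cast this
    linarith
  set QU := Q.filter fun v => v ∈ U with hQU
  have hXpos : 0 < X.card := (hY.mono hYX).card_pos
  have hDne : D.Nonempty := by
    rw [← Finset.card_pos]
    have : (0 : ℝ) < D.card := lt_of_le_of_lt (by positivity) hDcard
    exact_mod_cast this
  have hfail : ∀ q ∈ QU, ((D.filter fun z => q + z ∉ Q).card : ℝ) ≤ θ ^ 2 * X.card := by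
    intro q hq
    obtain ⟨x, hx, hqx⟩ := (Finset.mem_filter.1 (Finset.mem_filter.1 hq).1).2
    refine le_trans ?_ (hst x hx)
    rw [Nat.cast_le]
    apply Finset.card_le_card
    intro z hz
    simp only [Finset.mem_filter, hD] at hz ⊢
    refine ⟨hz.1.1, fun hmem => hz.2 ?_⟩
    obtain ⟨y, hy, x', hx', hyx⟩ := Finset.mem_add.1 hmem
    simp only [hQ, Finset.mem_filter, Finset.mem_univ, true_and]
    refine ⟨x', hx', ?_⟩
    have : q + z + x' = (q + x) + y := by
      have h1 : z = y + x' + x := by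
        rw [hyx, add_comm x z, add_assoc, hself, add_zero]
      rw [h1]
      have : q + (y + x' + x) + x' = (q + x + y) + (x' + x') := by abel
      rw [this, hself, add_zero]
    rw [this]
    exact W.add_mem hqx (hYW y hy)
  -- Double counting: each `q` fails for at most `θ² |X|` of the more than `θ |X|` elements of `D`,
  -- so some `z` fails for at most a proportion `θ` of `QU`. For this `z ∉ U` the disjoint sets `QU`
  -- and `G + z` give the factor `2 - θ`.
  obtain ⟨z, hzD, hz⟩ : ∃ z ∈ D, ((QU.filter fun q => q + z ∉ Q).card : ℝ) ≤ θ * QU.card := by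
    by_contra! hc
    have h1 := Finset.sum_lt_sum_of_nonempty hDne hc
    have h2 : ∑ z ∈ D, ((QU.filter fun q => q + z ∉ Q).card : ℝ)
        = ∑ q ∈ QU, ((D.filter fun z => q + z ∉ Q).card : ℝ) := by
      exact_mod_cast (Finset.sum_card_bipartiteAbove_eq_sum_card_bipartiteBelow
          (s := QU) (t := D) (fun q z => q + z ∉ Q)).symm
    have h3 := Finset.sum_le_sum hfail
    rw [h2] at h1
    simp only [Finset.sum_const, nsmul_eq_mul] at h1 h3
    have h4 : θ * X.card * (θ * QU.card) ≤ D.card * (θ * QU.card) :=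
      mul_le_mul_of_nonneg_right hDcard.le (by positivity)
    nlinarith
  have hzX : z ∈ X := (Finset.mem_filter.1 hzD).1
  have hzU : z ∉ U := (Finset.mem_filter.1 hzD).2
  refine ⟨U ⊔ Submodule.span (ZMod 2) {z}, hWU.trans le_sup_left, ?_, ?_⟩
  · have h1 := Submodule.finrank_add_le_finrank_add_finrank U (Submodule.span (ZMod 2) {z})
    have h2 : Module.finrank (ZMod 2) (Submodule.span (ZMod 2) {z}) ≤ 1 := by
      have := finrank_span_finset_le_card (R := ZMod 2) ({z} : Finset V)
      rwa [Finset.coe_singleton, Finset.card_singleton] at this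
    omega
  · set G := QU.filter fun q => q + z ∈ Q with hG
    have hzS : z ∈ U ⊔ Submodule.span (ZMod 2) {z} :=
      Submodule.mem_sup_right (Submodule.mem_span_singleton_self z)
    have hsub : QU ∪ G.image (· + z) ⊆ Q.filter fun v => v ∈ U ⊔ Submodule.span (ZMod 2) {z} := by
      intro v hv
      rw [Finset.mem_union, Finset.mem_image] at hv
      rw [Finset.mem_filter]
      rcases hv with hv | ⟨q, hq, rfl⟩
      · exact ⟨(Finset.mem_filter.1 hv).1, Submodule.mem_sup_left (Finset.mem_filter.1 hv).2⟩
      · have hq' := Finset.mem_filter.1 hq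
        exact ⟨hq'.2, Submodule.add_mem _
          (Submodule.mem_sup_left (Finset.mem_filter.1 hq'.1).2) hzS⟩
    have hdisj : Disjoint QU (G.image (· + z)) := by
      rw [Finset.disjoint_right]
      intro v hv hvQ
      obtain ⟨q, hq, rfl⟩ := Finset.mem_image.1 hv
      have hqU : q ∈ U := (Finset.mem_filter.1 (Finset.mem_filter.1 hq).1).2
      exact hzU ((U.add_mem_iff_right hqU).1 (Finset.mem_filter.1 hvQ).2)
    have h1 := Finset.card_le_card hsub
    rw [Finset.card_union_of_disjoint hdisj,
      Finset.card_image_of_injective _ (add_left_injective z)] at h1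
    have h1' : (QU.card : ℝ) + G.card
        ≤ (Q.filter fun v => v ∈ U ⊔ Submodule.span (ZMod 2) {z}).card := by exact_mod_cast h1
    have h2 := Finset.card_filter_add_card_filter_not (s := QU) (fun q => q + z ∈ Q)
    have h2' : (G.card : ℝ) + (QU.filter fun q => q + z ∉ Q).card = QU.card := by
      exact_mod_cast h2
    calc (2 - θ) ^ (j + 1) * w = (2 - θ) * ((2 - θ) ^ j * w) := by ring
      _ ≤ (2 - θ) * QU.card := mul_le_mul_of_nonneg_left hUQ (by linarith)
      _ ≤ _ := by linarith

/-- Translates by elements of `X` that are independent modulo `U` are disjoint on `U`. -/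
theorem exists_disjoint_translates {V : Type*} [AddCommGroup V] [Module (ZMod 2) V]
    [Fintype V] (X : Finset V) (U : Submodule (ZMod 2) V) :
    ∃ R ⊆ X, ∃ U' : Submodule (ZMod 2) V, U ≤ U' ∧ (∀ x ∈ X, x ∈ U') ∧
      Module.finrank (ZMod 2) U' ≤ Module.finrank (ZMod 2) U + R.card ∧
      ∀ Z : Finset V, (∀ z ∈ Z, z ∈ U) → R.card * Z.card ≤ (R + Z).card := by
  set p : Finset V → Prop := fun R =>
    ∀ Z : Finset V, (∀ z ∈ Z, z ∈ U) → R.card * Z.card ≤ (R + Z).card with hp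
  obtain ⟨R, hR, hmax⟩ := Finset.exists_max_image (X.powerset.filter p) Finset.card
    ⟨∅, by simp [hp]⟩
  simp only [Finset.mem_filter, Finset.mem_powerset] at hR hmax
  refine ⟨R, hR.1, U ⊔ Submodule.span (ZMod 2) (R : Set V), le_sup_left, ?_, ?_, hR.2⟩
  · intro x hx
    by_contra hxU
    have hxR : x ∉ R := fun h => hxU (Submodule.mem_sup_right (Submodule.subset_span h))
    have hpi : p (insert x R) := by
      intro Z hZ
      -- A common element would express `x` through `U` and `R`. Hence maximality of `R` forces all
      -- of `X` into the span.
      have hdisj : Disjoint (Z.image (x + ·)) (R + Z) := by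
        rw [Finset.disjoint_left]
        intro t ht ht'
        obtain ⟨z, hz, rfl⟩ := Finset.mem_image.1 ht
        obtain ⟨a, ha, b, hb, hab⟩ := Finset.mem_add.1 ht'
        have h1 : a + b ∈ U ⊔ Submodule.span (ZMod 2) (R : Set V) :=
          Submodule.add_mem _ (Submodule.mem_sup_right (Submodule.subset_span ha))
            (Submodule.mem_sup_left (hZ b hb))
        rw [hab] at h1
        exact hxU ((Submodule.add_mem_iff_left _ (Submodule.mem_sup_left (hZ z hz))).1 h1)
      have hsub : Z.image (x + ·) ∪ (R + Z) ⊆ insert x R + Z := by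
        intro t ht
        rw [Finset.mem_union, Finset.mem_image] at ht
        rcases ht with ⟨z, hz, rfl⟩ | ht
        · exact Finset.add_mem_add (Finset.mem_insert_self _ _) hz
        · exact Finset.add_subset_add_right (Finset.subset_insert _ _) ht
      have h1 := Finset.card_le_card hsub
      rw [Finset.card_union_of_disjoint hdisj,
        Finset.card_image_of_injective _ (add_right_injective x)] at h1
      rw [Finset.card_insert_of_notMem hxR]
      have := hR.2 Z hZ
      linarith
    have := hmax (insert x R) ⟨Finset.insert_subset hx hR.1, hpi⟩
    rw [Finset.card_insert_of_notMem hxR] at this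
    omega
  · have h1 := Submodule.finrank_add_le_finrank_add_finrank U (Submodule.span (ZMod 2) (R : Set V))
    have h2 := finrank_span_finset_le_card (R := ZMod 2) R
    simp only [Set.finrank] at h2
    omega

/-- `(1 - ρ) ^ m` is at most `c` as soon as `ρ * m ≥ log (1 / c)`. -/
theorem one_sub_pow_le_of_log_le {ρ c : ℝ} (hρ1 : ρ ≤ 1) (hc : 0 < c) {m : ℕ}
    (h : -Real.log c ≤ ρ * m) : (1 - ρ) ^ m ≤ c := by
  calc (1 - ρ) ^ m ≤ (Real.exp (-ρ)) ^ m := by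
        apply pow_le_pow_left₀ (by linarith)
        have := Real.add_one_le_exp (-ρ)
        linarith
    _ = Real.exp (-(ρ * m)) := by rw [← Real.exp_nat_mul]; congr 1; ring
    _ ≤ Real.exp (Real.log c) := Real.exp_le_exp.2 (by linarith)
    _ = c := Real.exp_log hc

/-- Inside a large part `X'` of an almost closed set `X` there are two small sets with large
sumset. -/
theorem exists_small_sets_large_sumset {V : Type*} [AddCommGroup V] [Module (ZMod 2) V]
    (X Y X' : Finset V) (hX' : X' ⊆ X) {θ : ℝ} (hθ0 : 0 < θ) (hθ1 : θ < 1) {s m m' : ℕ}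
    (hs0 : 0 < s) (hm0 : 0 < m)
    (hX'c : (1 - θ) * X.card ≤ (X'.card : ℝ)) (hYs : Y.card ≤ s)
    (hst : ∀ x ∈ X, ((X.filter fun z => x + z ∉ Y + X).card : ℝ) ≤ θ ^ 2 * X.card)
    (hmX : m ≤ X'.card) (hmm : X.card * s * (-Real.log θ) ≤ θ * m * m') :
    ∃ A ⊆ X', ∃ B ⊆ X', A.card = m ∧ B.card ≤ m' ∧
      (1 - 4 * θ) * X.card ≤ ((A + B).card : ℝ) := by
  have hself : ∀ v : V, v + v = 0 := fun v => ZModModule.add_self v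
  obtain ⟨A, hAX', hA⟩ := Finset.exists_subset_card_eq hmX
  have hm0' : (0 : ℝ) < m := by exact_mod_cast hm0
  have hs0' : (0 : ℝ) < s := by exact_mod_cast hs0
  have hX'pos : 0 < X'.card := lt_of_lt_of_le hm0 hmX
  have hXpos : 0 < X.card := lt_of_lt_of_le hX'pos (Finset.card_le_card hX')
  have hXpos' : (0 : ℝ) < X.card := by exact_mod_cast hXpos
  have hXX : (X'.card : ℝ) ≤ X.card := by exact_mod_cast Finset.card_le_card hX'
  have hmXr : (m : ℝ) ≤ X'.card := by exact_mod_cast hmX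
  set k : ℝ := (X.card : ℝ) with hk
  set P := Y + X with hP
  have hPcard : (P.card : ℝ) ≤ s * k := by
    have h1 : P.card ≤ Y.card * X.card := Finset.card_add_le
    have h2 : Y.card * X.card ≤ s * X.card := Nat.mul_le_mul_right _ hYs
    rw [hk]
    exact_mod_cast h1.trans h2
  -- A target with at least `θ m / s` representations in `A + X'` is hit by at least a proportion
  -- `ρ` of `X'`.
  set ρ : ℝ := θ * m / (s * k) with hρ
  have hs1 : (1 : ℝ) ≤ s := by exact_mod_cast hs0
  have hρ0 : 0 ≤ ρ := by positivity
  have hρ1 : ρ ≤ 1 := by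
    rw [hρ, div_le_one (by positivity)]
    nlinarith
  set c : V → ℕ := fun t => (A.filter fun a => t + a ∈ X').card with hc
  set T := P.filter fun t => θ / s * m ≤ (c t : ℝ) with hT
  have hcm : ∀ t, (c t : ℝ) ≤ m := fun t => by
    rw [← hA]; exact_mod_cast Finset.card_le_card (Finset.filter_subset _ _)
  have hsum1 : (m : ℝ) * ((1 - 2 * θ) * k) ≤ ∑ t ∈ P, (c t : ℝ) := by
    have h2 : ∑ t ∈ P, (c t : ℝ) = ∑ a ∈ A, ((P.filter fun t => t + a ∈ X').card : ℝ) := by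
      simp only [hc]
      exact_mod_cast (Finset.sum_card_bipartiteAbove_eq_sum_card_bipartiteBelow
          (s := P) (t := A) (fun t a => t + a ∈ X'))
    rw [h2, ← hA, ← nsmul_eq_mul, ← Finset.sum_const]
    refine Finset.sum_le_sum fun a ha => ?_
    have h3 := hst a (hX' (hAX' ha))
    have h4 : (X'.filter fun z => a + z ∈ P).card ≤ (P.filter fun t => t + a ∈ X').card := by
      apply Finset.card_le_card_of_injOn (fun z => a + z)
      · intro z hz
        simp only [Finset.coe_filter, Set.mem_ofPred_eq] at hz ⊢
        refine ⟨hz.2, ?_⟩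
        have : a + z + a = z := by rw [add_comm a z, add_assoc, hself, add_zero]
        rw [this]; exact hz.1
      · exact (add_right_injective a).injOn
    have h5 := Finset.card_filter_add_card_filter_not (s := X') (fun z => a + z ∈ P)
    have h6 : (X'.filter fun z => a + z ∉ P).card ≤ (X.filter fun z => a + z ∉ P).card :=
      Finset.card_le_card (Finset.filter_subset_filter _ hX')
    have h4' : ((X'.filter fun z => a + z ∈ P).card : ℝ) ≤ (P.filter fun t => t + a ∈ X').card := by
      exact_mod_cast h4
    have h5' : ((X'.filter fun z => a + z ∈ P).card : ℝ) + (X'.filter fun z => a + z ∉ P).card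
      = X'.card := by exact_mod_cast h5
    have h6' : ((X'.filter fun z => a + z ∉ P).card : ℝ) ≤ (X.filter fun z => a + z ∉ P).card := by
      exact_mod_cast h6
    have h7 : θ ^ 2 * k ≤ θ * k := by nlinarith
    linarith
  -- The unpopular sums in `P` carry at most `|P| θ m / s ≤ θ m k` representations out of at least
  -- `(1 - 2θ) m k`, and each popular one carries at most `m`.
  have hTcard : (1 - 3 * θ) * k ≤ (T.card : ℝ) := by
    have h1 : ∑ t ∈ P, (c t : ℝ) ≤ ∑ t ∈ P, ((if t ∈ T then (m : ℝ) else 0) + θ / s * m) := by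
      refine Finset.sum_le_sum fun t ht => ?_
      split_ifs with h
      · have := hcm t
        have : 0 ≤ θ / s * m := by positivity
        linarith
      · simp only [hT, Finset.mem_filter, not_and, not_le] at h
        linarith [h ht]
    rw [Finset.sum_add_distrib, Finset.sum_ite_mem, Finset.sum_const, Finset.sum_const,
      Finset.inter_eq_right.2 (Finset.filter_subset _ _), nsmul_eq_mul, nsmul_eq_mul] at h1
    have h2 : (P.card : ℝ) * (θ / s * m) ≤ s * k * (θ / s * m) :=
      mul_le_mul_of_nonneg_right hPcard (by positivity)
    have h3 : s * k * (θ / s * m) = θ * k * m := by field_simp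
    have h4 : (m : ℝ) * ((1 - 3 * θ) * k) ≤ m * T.card := by linarith
    exact le_of_mul_le_mul_left h4 hm0'
  obtain ⟨r, hr⟩ : ∃ r : V → V → Prop, ∀ t b, r t b ↔ ∃ a ∈ A, t = a + b :=
    ⟨_, fun _ _ => Iff.rfl⟩
  obtain ⟨B, hBX, hBm, hB⟩ := exists_hitting_set T X' r hρ1
    (Finset.card_pos.1 hX'pos) (fun t ht => by
      have h1 := (Finset.mem_filter.1 ht).2
      have h2 : c t ≤ (X'.filter fun b => r t b).card := by
        apply Finset.card_le_card_of_injOn (fun a => t + a)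
        · intro a ha
          simp only [Finset.coe_filter, Set.mem_ofPred_eq] at ha ⊢
          refine ⟨ha.2, (hr _ _).2 ⟨a, ha.1, ?_⟩⟩
          rw [add_comm t a, ← add_assoc, hself, zero_add]
        · exact (add_right_injective t).injOn
      have h2' : (c t : ℝ) ≤ (X'.filter fun b => r t b).card := by exact_mod_cast h2
      calc ρ * X'.card ≤ ρ * k := mul_le_mul_of_nonneg_left hXX hρ0
        _ = θ / s * m := by rw [hρ]; field_simp
        _ ≤ _ := h1.trans h2') m'
  refine ⟨A, hAX', B, hBX, hA, hBm, ?_⟩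
  have hpow : (1 - ρ) ^ m' ≤ θ := by
    apply one_sub_pow_le_of_log_le hρ1 hθ0
    rw [hρ, div_mul_eq_mul_div, le_div_iff₀ (by positivity)]
    linarith
  have h1 := Finset.card_filter_add_card_filter_not (s := T)
    (fun t => ∀ b ∈ B, ¬ r t b)
  have h2 : (T.filter fun t => ¬ ∀ b ∈ B, ¬ r t b) ⊆ A + B := by
    intro t ht
    have := (Finset.mem_filter.1 ht).2
    push Not at this
    obtain ⟨b, hb, hrb⟩ := this
    obtain ⟨a, ha, rfl⟩ := (hr _ _).1 hrb
    exact Finset.add_mem_add ha hb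
  have h3 := Finset.card_le_card h2
  have h1' : ((T.filter fun t => ∀ b ∈ B, ¬ r t b).card : ℝ) +
    (T.filter fun t => ¬ ∀ b ∈ B, ¬ r t b).card = T.card := by exact_mod_cast h1
  have h3' : ((T.filter fun t => ¬ ∀ b ∈ B, ¬ r t b).card : ℝ) ≤ (A + B).card := by
    exact_mod_cast h3
  have h4 : (1 - ρ) ^ m' * T.card ≤ θ * T.card :=
    mul_le_mul_of_nonneg_right hpow (by positivity)
  have h5 : (1 - θ) * ((1 - 3 * θ) * k) ≤ (1 - θ) * T.card :=
    mul_le_mul_of_nonneg_left hTcard (by linarith)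
  have h6 : (1 - 4 * θ) * k ≤ (1 - θ) * ((1 - 3 * θ) * k) := by nlinarith [sq_nonneg θ]
  linarith

/-- Most of a subset `Z` of an almost closed set `X` is covered by `A + B + Y` for two small
subsets `A`, `B` of `X`. -/
theorem exists_small_cover_step {V : Type*} [AddCommGroup V] [Module (ZMod 2) V]
    (X Y Z : Finset V) (hZX : Z ⊆ X) {κ : ℝ} (hκ0 : 0 < κ) {s m m' : ℕ} (hs0 : 0 < s)
    (hm0 : 0 < m) (hYs : Y.card ≤ s)
    (hst : ∀ x ∈ X, ((X.filter fun z => x + z ∉ Y + X).card : ℝ) ≤ κ * X.card)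
    (hmX : 2 * m ≤ X.card) (hmm : 2 * X.card * s * (-Real.log (4 * κ)) ≤ (m : ℝ) * m') :
    ∃ A ⊆ X, ∃ B ⊆ X, A.card ≤ m ∧ B.card ≤ m' ∧
      ((Z.filter fun x => x ∉ A + B + Y).card : ℝ) ≤ 8 * κ * Z.card := by
  have hself : ∀ v : V, v + v = 0 := fun v => ZModModule.add_self v
  rcases Z.eq_empty_or_nonempty with rfl | hZ
  · exact ⟨∅, by simp, ∅, by simp, by simp, by simp, by simp⟩
  have hZpos : (0 : ℝ) < Z.card := by exact_mod_cast hZ.card_pos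
  have hm0' : (0 : ℝ) < m := by exact_mod_cast hm0
  have hs1 : (1 : ℝ) ≤ s := by exact_mod_cast hs0
  have hXne : X.Nonempty := hZ.mono hZX
  have hXpos' : (0 : ℝ) < X.card := by exact_mod_cast hXne.card_pos
  have hmXr : 2 * (m : ℝ) ≤ X.card := by exact_mod_cast hmX
  set k : ℝ := (X.card : ℝ) with hk
  set P := Y + X with hP
  set f : V → ℕ := fun a => (Z.filter fun x => x + a ∉ P).card with hf
  have hfsum : ∑ a ∈ X, (f a : ℝ) ≤ Z.card * (κ * k) := by
    have h2 : ∑ a ∈ X, (f a : ℝ) = ∑ x ∈ Z, ((X.filter fun a => x + a ∉ P).card : ℝ) := by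
      simp only [hf]
      exact_mod_cast (Finset.sum_card_bipartiteAbove_eq_sum_card_bipartiteBelow
          (s := Z) (t := X) (fun x a => x + a ∉ P)).symm
    rw [h2, ← nsmul_eq_mul, ← Finset.sum_const]
    exact Finset.sum_le_sum fun x hx => hst x (hZX hx)
  -- By Markov's inequality at least half of `X` has at most twice the average number of failures,
  -- so `A` can be chosen inside `G`.
  set G := X.filter fun a => (f a : ℝ) ≤ 2 * κ * Z.card with hG
  have hGcard : m ≤ G.card := by
    have h1 := Finset.card_filter_add_card_filter_not (s := X)
      (fun a => (f a : ℝ) ≤ 2 * κ * Z.card)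
    set G' := X.filter fun a => ¬ (f a : ℝ) ≤ 2 * κ * Z.card with hG'
    have h1' : (G.card : ℝ) + G'.card = k := by rw [hk]; exact_mod_cast h1
    have h2 : (G'.card : ℝ) * (2 * κ * Z.card) ≤ Z.card * (κ * k) := by
      refine le_trans ?_ hfsum
      rw [← nsmul_eq_mul, ← Finset.sum_const]
      refine (Finset.sum_le_sum fun a ha => ?_).trans
        (Finset.sum_le_sum_of_subset_of_nonneg (Finset.filter_subset _ _)
          (fun _ _ _ => by positivity))
      exact (not_le.1 (Finset.mem_filter.1 ha).2).le
    have h3 : κ * Z.card * (2 * (G'.card : ℝ)) ≤ κ * Z.card * k := by linarith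
    have h4 := le_of_mul_le_mul_left h3 (by positivity)
    have : (m : ℝ) ≤ G.card := by linarith
    exact_mod_cast this
  obtain ⟨A, hAG, hA⟩ := Finset.exists_subset_card_eq hGcard
  have hAX : A ⊆ X := hAG.trans (Finset.filter_subset _ _)
  set c : V → ℕ := fun x => (A.filter fun a => x + a ∈ P).card with hc
  set c' : V → ℕ := fun x => (A.filter fun a => x + a ∉ P).card with hc'
  have hcc : ∀ x, (c x : ℝ) + c' x = m := fun x => by
    have := Finset.card_filter_add_card_filter_not (s := A) (fun a => x + a ∈ P)
    rw [← hA]; exact_mod_cast this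
  have hc'sum : ∑ x ∈ Z, (c' x : ℝ) ≤ m * (2 * κ * Z.card) := by
    have h2 : ∑ x ∈ Z, (c' x : ℝ) = ∑ a ∈ A, (f a : ℝ) := by
      simp only [hf, hc']
      exact_mod_cast (Finset.sum_card_bipartiteAbove_eq_sum_card_bipartiteBelow
          (s := Z) (t := A) (fun x a => x + a ∉ P))
    rw [h2, ← hA, ← nsmul_eq_mul, ← Finset.sum_const]
    exact Finset.sum_le_sum fun a ha => (Finset.mem_filter.1 (hAG ha)).2
  set T := Z.filter fun x => (m : ℝ) / 2 ≤ c x with hT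
  set T' := Z.filter fun x => ¬ (m : ℝ) / 2 ≤ c x with hT'
  have hTT : (T.card : ℝ) + T'.card = Z.card := by
    exact_mod_cast Finset.card_filter_add_card_filter_not (s := Z) (fun x => (m : ℝ) / 2 ≤ c x)
  have hT'card : (T'.card : ℝ) ≤ 4 * κ * Z.card := by
    have h2 : (T'.card : ℝ) * (m / 2) ≤ m * (2 * κ * Z.card) := by
      refine le_trans ?_ hc'sum
      rw [← nsmul_eq_mul, ← Finset.sum_const]
      refine (Finset.sum_le_sum fun x hx => ?_).trans
        (Finset.sum_le_sum_of_subset_of_nonneg (Finset.filter_subset _ _)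
          (fun _ _ _ => by positivity))
      have := not_le.1 (Finset.mem_filter.1 hx).2
      linarith [hcc x]
    have h3 : (m : ℝ) * T'.card ≤ m * (4 * κ * Z.card) := by linarith
    exact le_of_mul_le_mul_left h3 hm0'
  set ρ : ℝ := m / (2 * s * k) with hρ
  have hρ1 : ρ ≤ 1 := by
    rw [hρ, div_le_one (by positivity)]
    nlinarith
  obtain ⟨r, hr⟩ : ∃ r : V → V → Prop, ∀ x b, r x b ↔ ∃ a ∈ A, ∃ y ∈ Y, x = a + b + y :=
    ⟨_, fun _ _ => Iff.rfl⟩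
  have hrel : ∀ x ∈ T, ρ * k ≤ ((X.filter fun b => r x b).card : ℝ) := by
    intro x hx
    have h1 := (Finset.mem_filter.1 hx).2
    set E := X.filter fun b => r x b with hE
    -- If `x + a = y + b` then `x = a + b + y`, and `a` is recovered from `(y, b)`. So the good `a`
    -- number at most `s` times the good `b`.
    have h2 : (A.filter fun a => x + a ∈ P).card ≤ (Y ×ˢ E).card := by
      have hsub : (A.filter fun a => x + a ∈ P) ⊆ (Y ×ˢ E).image (fun q => x + (q.1 + q.2)) := by
        intro a ha
        obtain ⟨haA, haP⟩ := Finset.mem_filter.1 ha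
        obtain ⟨y, hy, b, hb, hyb⟩ := Finset.mem_add.1 haP
        refine Finset.mem_image.2 ⟨(y, b), Finset.mem_product.2 ⟨hy, Finset.mem_filter.2
          ⟨hb, (hr _ _).2 ⟨a, haA, y, hy, ?_⟩⟩⟩, ?_⟩
        · have : a + b + y = a + (y + b) := by abel
          rw [this, hyb, add_comm x a, ← add_assoc, hself, zero_add]
        · simp only [hyb]
          rw [← add_assoc, hself, zero_add]
      exact (Finset.card_le_card hsub).trans Finset.card_image_le
    rw [Finset.card_product] at h2
    have h3 : c x ≤ s * E.card := h2.trans (Nat.mul_le_mul_right _ hYs)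
    have h3' : (c x : ℝ) ≤ s * E.card := by exact_mod_cast h3
    have h4 : ρ * k = m / (2 * s) := by rw [hρ]; field_simp
    rw [h4, div_le_iff₀ (by positivity)]
    linarith
  obtain ⟨B, hBX, hBm, hB⟩ := exists_hitting_set T X r hρ1 hXne hrel m'
  refine ⟨A, hAX, B, hBX, hA.le, hBm, ?_⟩
  have hpow : (1 - ρ) ^ m' ≤ 4 * κ := by
    apply one_sub_pow_le_of_log_le hρ1 (by positivity)
    rw [hρ, div_mul_eq_mul_div, le_div_iff₀ (by positivity)]
    linarith
  have h1 : (Z.filter fun x => x ∉ A + B + Y) ⊆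
      T' ∪ T.filter fun x => ∀ b ∈ B, ¬ r x b := by
    intro x hx
    obtain ⟨hxZ, hxn⟩ := Finset.mem_filter.1 hx
    rw [Finset.mem_union, Finset.mem_filter, Finset.mem_filter, Finset.mem_filter]
    by_cases h : (m : ℝ) / 2 ≤ c x
    · refine Or.inr ⟨⟨hxZ, h⟩, fun b hb hrb => hxn ?_⟩
      obtain ⟨a, ha, y, hy, h'⟩ := (hr _ _).1 hrb
      rw [h']
      exact Finset.add_mem_add (Finset.add_mem_add ha hb) hy
    · exact Or.inl ⟨hxZ, h⟩
  have h2 := (Finset.card_le_card h1).trans (Finset.card_union_le _ _)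
  have h2' : ((Z.filter fun x => x ∉ A + B + Y).card : ℝ) ≤ T'.card +
      (T.filter fun x => ∀ b ∈ B, ¬ r x b).card := by exact_mod_cast h2
  have h3 : (1 - ρ) ^ m' * (T.card : ℝ) ≤ 4 * κ * T.card :=
    mul_le_mul_of_nonneg_right hpow (by positivity)
  have h4 : 4 * κ * (T.card : ℝ) ≤ 4 * κ * Z.card :=
    mul_le_mul_of_nonneg_left (by linarith [(Nat.cast_nonneg T'.card : (0 : ℝ) ≤ _)])
      (by positivity)
  linarith

/-- Two rounds of `exists_small_cover_step`. -/
theorem exists_small_cover {V : Type*} [AddCommGroup V] [Module (ZMod 2) V]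
    (X Y : Finset V) {κ : ℝ} (hκ0 : 0 < κ) {s m m' : ℕ} (hs0 : 0 < s)
    (hm0 : 0 < m) (hYs : Y.card ≤ s)
    (hst : ∀ x ∈ X, ((X.filter fun z => x + z ∉ Y + X).card : ℝ) ≤ κ * X.card)
    (hmX : 2 * m ≤ X.card) (hmm : 2 * X.card * s * (-Real.log (4 * κ)) ≤ (m : ℝ) * m') :
    ∃ A ⊆ X, ∃ B ⊆ X, A.card ≤ 2 * m ∧ B.card ≤ 2 * m' ∧
      ((X.filter fun x => x ∉ A + B + Y).card : ℝ) ≤ 64 * κ ^ 2 * X.card := by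
  obtain ⟨A₁, hA₁, B₁, hB₁, hA₁c, hB₁c, h₁⟩ :=
    exists_small_cover_step X Y X subset_rfl hκ0 hs0 hm0 hYs hst hmX hmm
  -- The second round treats only what the first left uncovered, so the loss `8 κ` is squared. This
  -- brings it below `κ / 2` for `κ < 1 / 128`, which one round cannot do and robustness of `Y`
  -- requires.
  obtain ⟨A₂, hA₂, B₂, hB₂, hA₂c, hB₂c, h₂⟩ :=
    exists_small_cover_step X Y (X.filter fun x => x ∉ A₁ + B₁ + Y) (Finset.filter_subset _ _)
      hκ0 hs0 hm0 hYs hst hmX hmm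
  refine ⟨A₁ ∪ A₂, Finset.union_subset hA₁ hA₂, B₁ ∪ B₂, Finset.union_subset hB₁ hB₂,
    (Finset.card_union_le _ _).trans (by omega), (Finset.card_union_le _ _).trans (by omega), ?_⟩
  have h3 : (X.filter fun x => x ∉ A₁ ∪ A₂ + (B₁ ∪ B₂) + Y) ⊆
      (X.filter fun x => x ∉ A₁ + B₁ + Y).filter fun x => x ∉ A₂ + B₂ + Y := by
    intro x hx
    obtain ⟨hxX, hxn⟩ := Finset.mem_filter.1 hx
    refine Finset.mem_filter.2 ⟨Finset.mem_filter.2 ⟨hxX, fun h => hxn ?_⟩, fun h => hxn ?_⟩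
    · exact Finset.add_subset_add_right
        (Finset.add_subset_add Finset.subset_union_left Finset.subset_union_left) h
    · exact Finset.add_subset_add_right
        (Finset.add_subset_add Finset.subset_union_right Finset.subset_union_right) h
  have h4 : ((X.filter fun x => x ∉ A₁ ∪ A₂ + (B₁ ∪ B₂) + Y).card : ℝ) ≤
      ((X.filter fun x => x ∉ A₁ + B₁ + Y).filter fun x => x ∉ A₂ + B₂ + Y).card := by
    exact_mod_cast Finset.card_le_card h3
  calc _ ≤ _ := h4
    _ ≤ _ := h₂
    _ ≤ 8 * κ * (8 * κ * X.card) := mul_le_mul_of_nonneg_left h₁ (by positivity)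
    _ = _ := by ring

end Combinatorics

/-! ### Encoding sumsets by coordinates in a short spanning family. -/

section Encoding

open scoped Pointwise Classical

/-- A basis is padded with zeros to length exactly `r`, so that codes for subspaces of different
dimensions share one type. -/
theorem exists_linearCombination_of_finrank_le {V : Type*} [AddCommGroup V] [Module (ZMod 2) V]
    [Finite V] (U : Submodule (ZMod 2) V) {r : ℕ} (hr : Module.finrank (ZMod 2) U ≤ r) :
    ∃ f : Fin r → V, ∀ u ∈ U, ∃ c, Fintype.linearCombination (ZMod 2) f c = u := by
  set b := Module.finBasis (ZMod 2) U
  set f : Fin r → V := fun i =>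
    if h : (i : ℕ) < Module.finrank (ZMod 2) U then (b ⟨i, h⟩ : V) else 0 with hf
  refine ⟨f, fun u hu => ?_⟩
  have h1 : u ∈ Submodule.span (ZMod 2) (Set.range f) := by
    have h2 : (⟨u, hu⟩ : U) ∈ Submodule.span (ZMod 2) (Set.range b) := by
      rw [b.span_eq]; trivial
    have h3 := Submodule.mem_map_of_mem (f := U.subtype) h2
    rw [Submodule.map_span] at h3
    refine Submodule.span_mono ?_ h3
    rintro _ ⟨_, ⟨i, rfl⟩, rfl⟩
    refine ⟨⟨i, lt_of_lt_of_le i.2 hr⟩, ?_⟩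
    simp [hf]
  rw [← Fintype.range_linearCombination] at h1
  exact h1

/-- A left inverse of an embedding `A ↪ Fin m` lists `A` with repetitions, so sets of size at most
`m` are coded by `m`-tuples. Nonemptiness supplies values for the spare indices. -/
theorem exists_image_univ_eq {α β : Type*} (g : β → α) {A : Finset α}
    (hA : A.Nonempty) {m : ℕ} (hm : A.card ≤ m) (hg : ∀ a ∈ A, ∃ c, g c = a) :
    ∃ a : Fin m → β, Finset.univ.image (fun i => g (a i)) = A := by
  obtain ⟨e⟩ : Nonempty (A ↪ Fin m) := by
    apply Function.Embedding.nonempty_of_card_le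
    simpa using hm
  have : Nonempty A := hA.to_subtype
  choose c hc using hg
  refine ⟨fun i => c _ (Function.invFun e i).2, ?_⟩
  ext x
  simp only [hc, Finset.mem_image, Finset.mem_univ, true_and]
  constructor
  · rintro ⟨i, rfl⟩
    exact (Function.invFun e i).2
  · intro hx
    exact ⟨e ⟨x, hx⟩, by rw [Function.leftInverse_invFun e.injective]⟩

/-- The number of subsets of size at most `k` of a set of size at most `2 ^ g * k`. -/
theorem card_subtype_card_le {α : Type*} [Fintype α] {g k : ℕ}
    (h : Fintype.card α ≤ 2 ^ g * k) :
    Fintype.card {s : Finset α // s.card ≤ k} ≤ 2 ^ ((g + 2) * k) := by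
  -- Generating function at `z = 2 ^ (-g)`: every small set has weight at least `z ^ k`, while the
  -- total weight is `(1 + z) ^ |α| ≤ e ^ k ≤ 4 ^ k`.
  have h0 := Fintype.sum_pow_mul_eq_add_pow α ((2 : ℝ)⁻¹ ^ g) 1
  simp only [one_pow, mul_one] at h0
  have h1 : (Fintype.card {s : Finset α // s.card ≤ k} : ℝ) * ((2 : ℝ)⁻¹ ^ g) ^ k ≤
      ∑ s : Finset α, ((2 : ℝ)⁻¹ ^ g) ^ s.card := by
    rw [Fintype.card_subtype, ← nsmul_eq_mul, ← Finset.sum_const]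
    refine (Finset.sum_le_sum fun s hs => ?_).trans
      (Finset.sum_le_sum_of_subset_of_nonneg (Finset.filter_subset _ _)
        (fun _ _ _ => by positivity))
    exact pow_le_pow_of_le_one (by positivity) (pow_le_one₀ (by norm_num) (by norm_num))
      (Finset.mem_filter.1 hs).2
  rw [h0] at h1
  have h2 : ((2 : ℝ)⁻¹ ^ g + 1) ^ Fintype.card α ≤ 4 ^ k := by
    calc ((2 : ℝ)⁻¹ ^ g + 1) ^ Fintype.card α
        ≤ ((2 : ℝ)⁻¹ ^ g + 1) ^ (2 ^ g * k) :=
          pow_le_pow_right₀ (by linarith [show (0 : ℝ) ≤ (2 : ℝ)⁻¹ ^ g by positivity]) h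
      _ = (((2 : ℝ)⁻¹ ^ g + 1) ^ (2 ^ g)) ^ k := by rw [pow_mul]
      _ ≤ 4 ^ k := by
        apply pow_le_pow_left₀ (by positivity)
        calc ((2 : ℝ)⁻¹ ^ g + 1) ^ (2 ^ g) ≤ (Real.exp ((2 : ℝ)⁻¹ ^ g)) ^ (2 ^ g) :=
              pow_le_pow_left₀ (by positivity) (Real.add_one_le_exp _) _
          _ = Real.exp 1 := by
              rw [← Real.exp_nat_mul]
              congr 1
              push_cast
              rw [← mul_pow]
              norm_num
          _ ≤ 4 := by linarith [Real.exp_one_lt_d9]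
  have h3 : (Fintype.card {s : Finset α // s.card ≤ k} : ℝ) ≤ 2 ^ ((g + 2) * k) := by
    have h4 : ((2 : ℝ)⁻¹ ^ g) ^ k * 2 ^ ((g + 2) * k) = 4 ^ k := by
      rw [← pow_mul, add_mul, pow_add, ← mul_assoc, ← mul_pow]
      norm_num [pow_mul]
    have h5 : (0 : ℝ) < ((2 : ℝ)⁻¹ ^ g) ^ k := by positivity
    refine le_of_mul_le_mul_left ?_ h5
    rw [h4]
    linarith
  exact_mod_cast h3

/-- Decodes a sumset of two small sets, given in coordinates. -/
noncomputable def sumsetOfCode {V : Type*} [AddCommGroup V] [Module (ZMod 2) V] {r m : ℕ}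
    (i : (Fin r → V) × (Fin m → Fin r → ZMod 2) × (Fin m → Fin r → ZMod 2)) : Finset V :=
  Finset.univ.image (fun l => Fintype.linearCombination (ZMod 2) i.1 (i.2.1 l)) +
    Finset.univ.image (fun l => Fintype.linearCombination (ZMod 2) i.1 (i.2.2 l))

/-- Decodes a sumset `Y + X` where `X` is a subset of `A + B + Y` and `A`, `B`, `Y` are given in
coordinates. -/
noncomputable def coveredSumsetOfCode {V : Type*} [AddCommGroup V] [Module (ZMod 2) V]
    {r m s k : ℕ}
    (i : (Fin r → V) × (Fin m → Fin r → ZMod 2) × (Fin m → Fin r → ZMod 2) ×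
      (Fin s → Fin r → ZMod 2) × {J : Finset (Fin m × Fin m × Fin s) // J.card ≤ k}) : Finset V :=
  Finset.univ.image (fun l => Fintype.linearCombination (ZMod 2) i.1 (i.2.2.2.1 l)) +
    i.2.2.2.2.1.image (fun q => Fintype.linearCombination (ZMod 2) i.1 (i.2.1 q.1) +
      Fintype.linearCombination (ZMod 2) i.1 (i.2.2.1 q.2.1) +
      Fintype.linearCombination (ZMod 2) i.1 (i.2.2.2.1 q.2.2))

theorem exists_sumsetOfCode_eq {V : Type*} [AddCommGroup V] [Module (ZMod 2) V] [Finite V]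
    (U : Submodule (ZMod 2) V) {r m : ℕ} (hr : Module.finrank (ZMod 2) U ≤ r) {A B : Finset V}
    (hA : A.Nonempty) (hB : B.Nonempty) (hAm : A.card ≤ m) (hBm : B.card ≤ m)
    (hAU : ∀ a ∈ A, a ∈ U) (hBU : ∀ b ∈ B, b ∈ U) :
    ∃ i : (Fin r → V) × (Fin m → Fin r → ZMod 2) × (Fin m → Fin r → ZMod 2),
      sumsetOfCode i = A + B := by
  obtain ⟨f, hf⟩ := exists_linearCombination_of_finrank_le U hr
  obtain ⟨a, ha⟩ := exists_image_univ_eq (Fintype.linearCombination (ZMod 2) f) hA hAm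
    (fun x hx => hf x (hAU x hx))
  obtain ⟨b, hb⟩ := exists_image_univ_eq (Fintype.linearCombination (ZMod 2) f) hB hBm
    (fun x hx => hf x (hBU x hx))
  exact ⟨(f, a, b), by simp only [sumsetOfCode, ha, hb]⟩

theorem exists_coveredSumsetOfCode_eq {V : Type*} [AddCommGroup V] [Module (ZMod 2) V] [Finite V]
    (U : Submodule (ZMod 2) V) {r m s k : ℕ} (hr : Module.finrank (ZMod 2) U ≤ r)
    {A B Y X : Finset V}
    (hA : A.Nonempty) (hB : B.Nonempty) (hY : Y.Nonempty) (hAm : A.card ≤ m) (hBm : B.card ≤ m)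
    (hYs : Y.card ≤ s) (hXk : X.card ≤ k)
    (hAU : ∀ a ∈ A, a ∈ U) (hBU : ∀ b ∈ B, b ∈ U) (hYU : ∀ y ∈ Y, y ∈ U)
    (hX : X ⊆ A + B + Y) :
    ∃ i : (Fin r → V) × (Fin m → Fin r → ZMod 2) × (Fin m → Fin r → ZMod 2) ×
      (Fin s → Fin r → ZMod 2) × {J : Finset (Fin m × Fin m × Fin s) // J.card ≤ k},
      coveredSumsetOfCode i = Y + X := by
  obtain ⟨f, hf⟩ := exists_linearCombination_of_finrank_le U hr
  obtain ⟨a, ha⟩ := exists_image_univ_eq (Fintype.linearCombination (ZMod 2) f) hA hAm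
    (fun x hx => hf x (hAU x hx))
  obtain ⟨b, hb⟩ := exists_image_univ_eq (Fintype.linearCombination (ZMod 2) f) hB hBm
    (fun x hx => hf x (hBU x hx))
  obtain ⟨y, hy⟩ := exists_image_univ_eq (Fintype.linearCombination (ZMod 2) f) hY hYs
    (fun x hx => hf x (hYU x hx))
  have hq : ∀ x ∈ X, ∃ q : Fin m × Fin m × Fin s,
      Fintype.linearCombination (ZMod 2) f (a q.1) + Fintype.linearCombination (ZMod 2) f (b q.2.1)
        + Fintype.linearCombination (ZMod 2) f (y q.2.2) = x := by
    intro x hx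
    obtain ⟨t, ht, v, hv, rfl⟩ := Finset.mem_add.1 (hX hx)
    obtain ⟨u, hu, w, hw, rfl⟩ := Finset.mem_add.1 ht
    rw [← ha] at hu
    rw [← hb] at hw
    rw [← hy] at hv
    obtain ⟨i, -, rfl⟩ := Finset.mem_image.1 hu
    obtain ⟨j, -, rfl⟩ := Finset.mem_image.1 hw
    obtain ⟨l, -, rfl⟩ := Finset.mem_image.1 hv
    exact ⟨(i, j, l), rfl⟩
  have : Nonempty (Fin m × Fin m × Fin s) := by
    exact ⟨⟨0, hA.card_pos.trans_le hAm⟩, ⟨0, hA.card_pos.trans_le hAm⟩,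
      ⟨0, hY.card_pos.trans_le hYs⟩⟩
  choose! q hq using hq
  refine ⟨(f, a, b, y, ⟨X.image q, Finset.card_image_le.trans hXk⟩), ?_⟩
  simp only [coveredSumsetOfCode, hy]
  congr 1
  rw [Finset.image_image]
  conv_rhs => rw [← Finset.image_id (s := X)]
  exact Finset.image_congr fun x hx => hq x hx

end Encoding

/-! ### Containment probabilities and the union bound. -/

section Probability

open scoped Pointwise Classical ENNReal

theorem IsRandomHalfSubset.measure_forall_mem {Ω G : Type*} [MeasurableSpace Ω] {P : Measure Ω}
    {A : Ω → Set G} (hA : IsRandomHalfSubset P A) (S : Finset G) :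
    P {ω | ∀ x ∈ S, x ∈ A ω} = ENNReal.ofReal (2 ^ (-(S.card : ℝ))) := by
  have h1 : {ω | ∀ x ∈ S, x ∈ A ω} = ⋂ x ∈ S, {ω | x ∈ A ω} := by ext; simp
  rw [h1, hA.indep.meas_biInter S, Finset.prod_congr rfl (fun x _ => hA.prob_mem x),
    Finset.prod_const, Real.rpow_neg (by norm_num), Real.rpow_natCast,
    ENNReal.ofReal_inv_of_pos (by positivity), ENNReal.ofReal_pow (by norm_num), one_div,
    ENNReal.inv_pow]
  simp

/-- Union bound over a family of sets whose nonzero elements are contained in a random set. -/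
theorem IsRandomHalfSubset.measure_exists_subset_le {Ω V ι : Type*} [MeasurableSpace Ω]
    [Zero V] {P : Measure Ω} {A : Ω → Set V} (hA : IsRandomHalfSubset P A) [Fintype ι]
    (S : ι → Finset V) {a b : ℝ} (ha : (Fintype.card ι : ℝ) ≤ 2 ^ a) :
    P {ω | ∃ i, b ≤ (S i).card ∧ ∀ x ∈ S i, x ≠ 0 → x ∈ A ω} ≤
      ENNReal.ofReal (2 ^ (a - b + 1)) := by
  have hsub : {ω | ∃ i, b ≤ (S i).card ∧ ∀ x ∈ S i, x ≠ 0 → x ∈ A ω} ⊆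
      ⋃ i ∈ Finset.univ.filter (fun i => b ≤ ((S i).card : ℝ)),
        {ω | ∀ x ∈ (S i).erase 0, x ∈ A ω} := by
    rintro ω ⟨i, hi, h⟩
    simp only [Set.mem_iUnion]
    refine ⟨i, by simpa using hi, fun x hx => ?_⟩
    rw [Finset.mem_erase] at hx
    exact h x hx.2 hx.1
  -- Discarding `0` loses at most one element, whence the extra `1` in the exponent.
  have hle : ∀ i ∈ Finset.univ.filter (fun i => b ≤ ((S i).card : ℝ)),
      P {ω | ∀ x ∈ (S i).erase 0, x ∈ A ω} ≤ ENNReal.ofReal (2 ^ (1 - b)) := by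
    intro i hi
    rw [hA.measure_forall_mem]
    apply ENNReal.ofReal_le_ofReal
    apply Real.rpow_le_rpow_of_exponent_le (by norm_num)
    have h1 := Finset.pred_card_le_card_erase (s := S i) (a := 0)
    have h2 : (S i).card ≤ ((S i).erase 0).card + 1 := by omega
    have h2' : ((S i).card : ℝ) ≤ ((S i).erase 0).card + 1 := by exact_mod_cast h2
    have := (Finset.mem_filter.1 hi).2
    linarith
  calc P _ ≤ _ := measure_mono hsub
    _ ≤ _ := measure_biUnion_finset_le _ _
    _ ≤ _ := Finset.sum_le_sum hle
    _ = ((Finset.univ.filter (fun i => b ≤ ((S i).card : ℝ))).card : ℝ≥0∞) *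
        ENNReal.ofReal (2 ^ (1 - b)) := by rw [Finset.sum_const, nsmul_eq_mul]
    _ ≤ ENNReal.ofReal (2 ^ a) * ENNReal.ofReal (2 ^ (1 - b)) := by
      gcongr
      rw [← ENNReal.ofReal_natCast]
      apply ENNReal.ofReal_le_ofReal
      refine le_trans ?_ ha
      exact_mod_cast Finset.card_le_univ _
    _ = _ := by
      rw [← ENNReal.ofReal_mul (by positivity), ← Real.rpow_add (by norm_num)]
      congr 2
      ring

end Probability

/-! ### The trichotomy for sumsets and the resulting clique probability. -/

section Structure

open scoped Pointwise Classical

/-- The sumset of every set of size `k` contains a large sumset with a short description. -/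
theorem exists_code_sumset_subset {V : Type*} [AddCommGroup V] [Module (ZMod 2) V] [Fintype V]
    (X : Finset V) {k : ℕ} (hXk : X.card = k) (hk : 0 < k) {θ : ℝ} (hθ0 : 0 < θ)
    (hθ1 : θ ≤ 1 / 12) {s₀ s₁ J m₀ : ℕ} (m : ℕ → ℕ) (hs₀ : 0 < s₀)
    (hJ : ∀ j : ℕ, (2 - θ) ^ j ≤ (k : ℝ) → j ≤ J)
    (hm₀ : 0 < m₀) (hm₀k : (m₀ : ℝ) ≤ (1 - θ) * k)
    (hm₀s : k * s₀ * (-Real.log θ) ≤ θ * m₀ * m₀)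
    (hm : ∀ s, s₀ ≤ s → s < s₁ →
      0 < m s ∧ 2 * m s ≤ k ∧ 2 * k * s * (-Real.log (4 * θ ^ 2)) ≤ (m s : ℝ) * m s) :
    (∃ i : (Fin (s₀ + J) → V) × (Fin m₀ → Fin (s₀ + J) → ZMod 2) ×
        (Fin m₀ → Fin (s₀ + J) → ZMod 2),
      (1 - 4 * θ) * k ≤ ((sumsetOfCode i).card : ℝ) ∧ sumsetOfCode i ⊆ X + X) ∨
    (∃ s ∈ Finset.Ico s₀ s₁, ∃ i : (Fin (2 * s + J) → V) ×
        (Fin (2 * m s) → Fin (2 * s + J) → ZMod 2) × (Fin (2 * m s) → Fin (2 * s + J) → ZMod 2) ×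
        (Fin s → Fin (2 * s + J) → ZMod 2) ×
        {J : Finset (Fin (2 * m s) × Fin (2 * m s) × Fin s) // J.card ≤ k},
      θ ^ 2 / 4 * k * s ≤ ((coveredSumsetOfCode i).card : ℝ) ∧ coveredSumsetOfCode i ⊆ X + X) ∨
    θ ^ 2 / 4 * k * s₁ ≤ ((X + X).card : ℝ) := by
  have hkr : (0 : ℝ) < k := by exact_mod_cast hk
  have hθsq : θ ^ 2 ≤ 1 / 144 := by nlinarith
  have hθsq0 : 0 < θ ^ 2 := by positivity
  -- With `δ = θ² / 2` the exceptional proportion `2 δ` is the `θ²` that the subspace lemma needs.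
  obtain ⟨Y, hYX, hrob, hst⟩ := exists_robust_expanding_subset X (δ := θ ^ 2 / 2) (by positivity)
  have hst' : ∀ x ∈ X, ((X.filter fun z => x + z ∉ Y + X).card : ℝ) ≤ θ ^ 2 * X.card := by
    intro x hx
    have := hst x hx
    linarith
  have hXne : X.Nonempty := Finset.card_pos.1 (hXk ▸ hk)
  have hY : Y.Nonempty := by
    by_contra hY
    rw [Finset.not_nonempty_iff_eq_empty] at hY
    obtain ⟨x, hx⟩ := hXne
    have := hst' x hx
    simp only [hY, Finset.empty_add, Finset.notMem_empty, not_false_eq_true,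
      Finset.filter_true, hXk] at this
    nlinarith
  obtain ⟨U, j, hYU, hUr, hj, hU⟩ :=
    exists_submodule_of_almost_closed X Y hYX hY hθ0 (by linarith) hst'
  obtain ⟨R, hRX, U', hUU', hXU', hU'r, hR⟩ := exists_disjoint_translates X U
  have hjJ : j ≤ J := hJ j (by rwa [hXk] at hj)
  rw [hXk] at hU hst'
  set s := (Y ∪ R).card with hs
  have hYs : Y.card ≤ s := Finset.card_le_card Finset.subset_union_left
  have hRs : R.card ≤ s := Finset.card_le_card Finset.subset_union_right
  have hYRX : Y ∪ R ⊆ X := Finset.union_subset hYX hRX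
  have hs1 : 0 < s := lt_of_lt_of_le hY.card_pos hYs
  -- `Y` expands by robustness and `R` expands on `Z ∩ U`, each giving at least `θ² k / 2` sums per
  -- element. The larger of the two bounds is at least their mean, and `|Y| + |R| ≥ s`, whence `θ² /
  -- 4`.
  have hsum : ∀ Z ⊆ X, ((X \ Z).card : ℝ) ≤ θ ^ 2 / 2 * k →
      θ ^ 2 / 4 * k * s ≤ (((Y ∪ R) + Z).card : ℝ) := by
    intro Z hZX hZ
    have h1 := hrob Z hZX (by rwa [hXk])
    rw [hXk] at h1
    have h2 := hR (Z.filter fun z => z ∈ U) (fun z hz => (Finset.mem_filter.1 hz).2)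
    have h3 : ((Y + Z).card : ℝ) ≤ ((Y ∪ R) + Z).card := by
      exact_mod_cast Finset.card_le_card (Finset.add_subset_add_right Finset.subset_union_left)
    have h4 : (R + Z.filter fun z => z ∈ U).card ≤ ((Y ∪ R) + Z).card :=
      Finset.card_le_card (Finset.add_subset_add Finset.subset_union_right
        (Finset.filter_subset _ _))
    have h5 : (R.card : ℝ) * (Z.filter fun z => z ∈ U).card ≤ ((Y ∪ R) + Z).card := by
      exact_mod_cast h2.trans h4
    have h6 : (X.filter fun z => z ∈ U) ⊆ (Z.filter fun z => z ∈ U) ∪ (X \ Z) := by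
      intro x hx
      simp only [Finset.mem_filter, Finset.mem_union, Finset.mem_sdiff] at hx ⊢
      tauto
    have h7 := (Finset.card_le_card h6).trans (Finset.card_union_le _ _)
    have h7' : ((X.filter fun z => z ∈ U).card : ℝ) ≤
        (Z.filter fun z => z ∈ U).card + (X \ Z).card := by exact_mod_cast h7
    have h8 : θ ^ 2 / 2 * k ≤ ((Z.filter fun z => z ∈ U).card : ℝ) := by nlinarith
    have h9 : (R.card : ℝ) * (θ ^ 2 / 2 * k) ≤ ((Y ∪ R) + Z).card :=
      (mul_le_mul_of_nonneg_left h8 (Nat.cast_nonneg _)).trans h5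
    have h10 : (s : ℝ) ≤ Y.card + R.card := by exact_mod_cast Finset.card_union_le Y R
    have h11 : θ ^ 2 / 4 * k * s ≤ θ ^ 2 / 4 * k * (Y.card + R.card) :=
      mul_le_mul_of_nonneg_left h10 (by positivity)
    linarith
  rcases lt_or_ge s s₀ with hss | hss
  · left
    set X' := X.filter fun x => x ∈ U with hX'
    have hX'X : X' ⊆ X := Finset.filter_subset _ _
    obtain ⟨A, hA, B, hB, hAc, hBc, hAB⟩ := exists_small_sets_large_sumset X Y X' hX'X hθ0
      (by linarith) hs₀ hm₀ (by rwa [hXk]) (hYs.trans hss.le) (by rwa [hXk])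
      (by exact_mod_cast hm₀k.trans hU) (m' := m₀) (by rwa [hXk])
    rw [hXk] at hAB
    have hABne : (A + B).Nonempty := by
      rw [← Finset.card_pos]
      have : (0 : ℝ) < (A + B).card := lt_of_lt_of_le (mul_pos (by linarith) hkr) hAB
      exact_mod_cast this
    obtain ⟨i, hi⟩ := exists_sumsetOfCode_eq U (r := s₀ + J) (by omega) hABne.of_add_left
      hABne.of_add_right hAc.le hBc (fun a ha => (Finset.mem_filter.1 (hA ha)).2)
      (fun b hb => (Finset.mem_filter.1 (hB hb)).2)
    exact ⟨i, by rw [hi]; exact hAB, by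
      rw [hi]; exact Finset.add_subset_add (hA.trans hX'X) (hB.trans hX'X)⟩
  rcases lt_or_ge s s₁ with hss₁ | hss₁
  · right; left
    obtain ⟨hms, hmk, hmm⟩ := hm s hss hss₁
    obtain ⟨A, hA, B, hB, hAc, hBc, hcov⟩ := exists_small_cover X Y hθsq0 hs1 hms hYs
      (by rwa [hXk]) (by rwa [hXk]) (m' := m s) (by rwa [hXk])
    rw [hXk] at hcov
    set Z := X.filter fun x => x ∈ A + B + Y with hZ
    have hXZ : X \ Z = X.filter fun x => x ∉ A + B + Y := by
      ext x
      simp only [hZ, Finset.mem_sdiff, Finset.mem_filter]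
      tauto
    have hcard : ((X \ Z).card : ℝ) ≤ θ ^ 2 / 2 * k := by
      rw [hXZ]
      refine hcov.trans (mul_le_mul_of_nonneg_right ?_ hkr.le)
      nlinarith
    have hZsub : Z ⊆ A + B + Y := fun x hx => (Finset.mem_filter.1 hx).2
    have hZX : Z ⊆ X := Finset.filter_subset _ _
    have hZne : Z.Nonempty := by
      by_contra h
      rw [Finset.not_nonempty_iff_eq_empty] at h
      rw [h, Finset.sdiff_empty, hXk] at hcard
      nlinarith
    have hABY := hZne.mono hZsub
    -- The larger subspace `U'` is needed because `R` need not lie in `U`. Its dimension is at most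
    -- `|Y| + j + |R| ≤ 2 s + J`.
    obtain ⟨i, hi⟩ := exists_coveredSumsetOfCode_eq U' (r := 2 * s + J) (k := k) (s := s)
      (A := A) (B := B) (Y := Y ∪ R) (X := Z) (by omega)
      hABY.of_add_left.of_add_left hABY.of_add_left.of_add_right (hY.mono Finset.subset_union_left)
      hAc hBc le_rfl ((Finset.card_le_card hZX).trans hXk.le) (fun a ha => hXU' a (hA ha))
      (fun a ha => hXU' a (hB ha)) (fun a ha => hXU' a (hYRX ha))
      (hZsub.trans (Finset.add_subset_add_left Finset.subset_union_left))
    refine ⟨s, Finset.mem_Ico.2 ⟨hss, hss₁⟩, i, ?_, ?_⟩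
    · rw [hi]; exact hsum Z hZX hcard
    · rw [hi]; exact Finset.add_subset_add hYRX hZX
  · right; right
    -- Here `s` is so large that no description is needed: `Z = X` is used and all `k`-tuples are
    -- counted.
    have h1 := hsum X subset_rfl (by simp; positivity)
    have h2 : (((Y ∪ R) + X).card : ℝ) ≤ (X + X).card := by
      exact_mod_cast Finset.card_le_card (Finset.add_subset_add_right hYRX)
    have h3 : (s₁ : ℝ) ≤ s := by exact_mod_cast hss₁
    have h4 : θ ^ 2 / 4 * k * s₁ ≤ θ ^ 2 / 4 * k * s :=
      mul_le_mul_of_nonneg_left h3 (by positivity)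
    linarith

/-- Bound for the probability that the random Cayley sum graph over `𝔽₂` has a clique of size `k`. -/
theorem IsRandomHalfSubset.measure_le_cliqueNum_le {V : Type*} [AddCommGroup V]
    [Module (ZMod 2) V] [Fintype V] {n : ℕ} (hV : Fintype.card V = 2 ^ n)
    {Ω : Type*} [MeasurableSpace Ω] {P : Measure Ω} {A : Ω → Set V} (hA : IsRandomHalfSubset P A)
    {k : ℕ} (hk : 0 < k) {θ : ℝ} (hθ0 : 0 < θ)
    (hθ1 : θ ≤ 1 / 12) {s₀ s₁ J m₀ : ℕ} (m g : ℕ → ℕ) (hs₀ : 0 < s₀)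
    (hJ : ∀ j : ℕ, (2 - θ) ^ j ≤ (k : ℝ) → j ≤ J)
    (hm₀ : 0 < m₀) (hm₀k : (m₀ : ℝ) ≤ (1 - θ) * k)
    (hm₀s : k * s₀ * (-Real.log θ) ≤ θ * m₀ * m₀)
    (hm : ∀ s, s₀ ≤ s → s < s₁ →
      0 < m s ∧ 2 * m s ≤ k ∧ 2 * k * s * (-Real.log (4 * θ ^ 2)) ≤ (m s : ℝ) * m s)
    (hg : ∀ s, s₀ ≤ s → s < s₁ → 2 * m s * (2 * m s * s) ≤ 2 ^ g s * k) :
    P {ω | k ≤ (cayleySumGraph (A ω)).cliqueNum} ≤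
      ENNReal.ofReal (2 ^ (((n + 2 * m₀) * (s₀ + J) - (1 - 4 * θ) * k + 1 : ℝ))) +
      ∑ s ∈ Finset.Ico s₀ s₁, ENNReal.ofReal
        (2 ^ (((n + 4 * m s + s) * (2 * s + J) + (g s + 2) * k - θ ^ 2 / 4 * k * s + 1 : ℝ))) +
      ENNReal.ofReal (2 ^ ((n * k - θ ^ 2 / 4 * k * s₁ + 1 : ℝ))) := by
  set E₁ : Set Ω := {ω | ∃ i : (Fin (s₀ + J) → V) ×
    (Fin m₀ → Fin (s₀ + J) → ZMod 2) × (Fin m₀ → Fin (s₀ + J) → ZMod 2),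
    (1 - 4 * θ) * k ≤ ((sumsetOfCode i).card : ℝ) ∧
      ∀ x ∈ sumsetOfCode i, x ≠ 0 → x ∈ A ω} with hE₁
  set E₂ : ℕ → Set Ω := fun s => {ω | ∃ i : (Fin (2 * s + J) → V) ×
        (Fin (2 * m s) → Fin (2 * s + J) → ZMod 2) × (Fin (2 * m s) → Fin (2 * s + J) → ZMod 2) ×
        (Fin s → Fin (2 * s + J) → ZMod 2) ×
        {J : Finset (Fin (2 * m s) × Fin (2 * m s) × Fin s) // J.card ≤ k},
      θ ^ 2 / 4 * k * s ≤ ((coveredSumsetOfCode i).card : ℝ) ∧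
      ∀ x ∈ coveredSumsetOfCode i, x ≠ 0 → x ∈ A ω} with hE₂
  set E₃ : Set Ω := {ω | ∃ i : Fin k → V,
    θ ^ 2 / 4 * k * s₁ ≤ ((Finset.univ.image i + Finset.univ.image i).card : ℝ) ∧
      ∀ x ∈ Finset.univ.image i + Finset.univ.image i, x ≠ 0 → x ∈ A ω} with hE₃
  have hsub : {ω | k ≤ (cayleySumGraph (A ω)).cliqueNum} ⊆
      (E₁ ∪ ⋃ s ∈ Finset.Ico s₀ s₁, E₂ s) ∪ E₃ := by
    intro ω hω
    obtain ⟨K, hK⟩ := (cayleySumGraph (A ω)).exists_isNClique_cliqueNum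
    obtain ⟨X, hXK, hXk⟩ := Finset.exists_subset_card_eq
      (show k ≤ K.card by rw [hK.card_eq]; exact hω)
    have hXX : ∀ x ∈ X + X, x ≠ 0 → x ∈ A ω := by
      intro x hx hx0
      obtain ⟨a, ha, b, hb, rfl⟩ := Finset.mem_add.1 hx
      have hab : a ≠ b := by
        rintro rfl
        exact hx0 (ZModModule.add_self a)
      exact (hK.isClique (hXK ha) (hXK hb) hab).2
    rcases exists_code_sumset_subset X hXk hk hθ0 hθ1 m hs₀ hJ hm₀ hm₀k hm₀s hm with
      ⟨i, hi, hiX⟩ | ⟨s, hs, i, hi, hiX⟩ | h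
    · exact Or.inl (Or.inl ⟨i, hi, fun x hx => hXX x (hiX hx)⟩)
    · refine Or.inl (Or.inr ?_)
      simp only [Set.mem_iUnion]
      exact ⟨s, hs, i, hi, fun x hx => hXX x (hiX hx)⟩
    · right
      obtain ⟨i, hi⟩ := exists_image_univ_eq (id : V → V)
        (Finset.card_pos.1 (hXk ▸ hk)) hXk.le (fun a _ => ⟨a, rfl⟩)
      refine ⟨i, ?_⟩
      have hi' : Finset.univ.image i = X := hi
      rw [hi']
      exact ⟨h, hXX⟩
  refine (measure_mono hsub).trans ((measure_union_le _ _).trans (add_le_add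
    ((measure_union_le _ _).trans (add_le_add ?_ ((measure_biUnion_finset_le _ _).trans
      (Finset.sum_le_sum fun s hs => ?_)))) ?_))
  · refine (hA.measure_exists_subset_le _ (a := (n + 2 * m₀) * (s₀ + J)) (le_of_eq ?_))
    simp only [Fintype.card_prod, Fintype.card_fun, Fintype.card_fin, ZMod.card, hV]
    have h1 : ((n : ℝ) + 2 * m₀) * (s₀ + J) =
        ((n * (s₀ + J) + ((s₀ + J) * m₀ + (s₀ + J) * m₀) : ℕ) : ℝ) := by push_cast; ring
    have h2 : (2 ^ n) ^ (s₀ + J) * ((2 ^ (s₀ + J)) ^ m₀ * (2 ^ (s₀ + J)) ^ m₀) =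
        2 ^ (n * (s₀ + J) + ((s₀ + J) * m₀ + (s₀ + J) * m₀)) := by ring
    rw [h1, h2, Real.rpow_natCast, Nat.cast_pow, Nat.cast_ofNat]
  · obtain ⟨h1, h2⟩ := Finset.mem_Ico.1 hs
    refine (hA.measure_exists_subset_le _
      (a := (n + 4 * m s + s) * (2 * s + J) + (g s + 2) * k) ?_)
    simp only [Fintype.card_prod, Fintype.card_fun, Fintype.card_fin, ZMod.card, hV]
    have h3 : Fintype.card {J : Finset (Fin (2 * m s) × Fin (2 * m s) × Fin s) // J.card ≤ k} ≤
        2 ^ ((g s + 2) * k) := by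
      apply card_subtype_card_le
      simpa only [Fintype.card_prod, Fintype.card_fin] using hg s h1 h2
    -- Bit count: `n` per spanning vector, one per coordinate of each listed element of `A`, `B` and
    -- `Y ∪ R`, and `(g + 2) k` for the chosen triples.
    have h4 : ((n : ℝ) + 4 * m s + s) * (2 * s + J) + (g s + 2) * k =
        ((n * (2 * s + J) + ((2 * s + J) * (2 * m s) + ((2 * s + J) * (2 * m s) +
          ((2 * s + J) * s + (g s + 2) * k))) : ℕ) : ℝ) := by push_cast; ring
    have h5 : (2 ^ n) ^ (2 * s + J) * ((2 ^ (2 * s + J)) ^ (2 * m s) *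
        ((2 ^ (2 * s + J)) ^ (2 * m s) * ((2 ^ (2 * s + J)) ^ s * 2 ^ ((g s + 2) * k)))) =
        2 ^ (n * (2 * s + J) + ((2 * s + J) * (2 * m s) + ((2 * s + J) * (2 * m s) +
          ((2 * s + J) * s + (g s + 2) * k)))) := by
      simp only [← pow_mul, ← pow_add]
    have h6 : ∀ N : ℕ, (2 : ℝ) ^ N = ((2 ^ N : ℕ) : ℝ) := fun N => by simp
    rw [h4, Real.rpow_natCast, h6, Nat.cast_le, ← h5]
    gcongr
  · refine (hA.measure_exists_subset_le _ (a := n * k) (le_of_eq ?_))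
    simp only [Fintype.card_fun, Fintype.card_fin, hV]
    rw [← pow_mul, Nat.cast_pow, Nat.cast_ofNat, ← Real.rpow_natCast, Nat.cast_mul]

end Structure

/-! ### Asymptotic comparison of `n`, `log n` and `k = ⌈(1 + ε) n log₂ n⌉`. -/

section Asymptotics

theorem tendsto_logb_two_natCast_atTop :
    Tendsto (fun n : ℕ => Real.logb 2 n) atTop atTop :=
  (Real.tendsto_logb_atTop (by norm_num)).comp tendsto_natCast_atTop_atTop

theorem tendsto_ceil_mul_logb_atTop {ε : ℝ} (hε : 0 < ε) :
    Tendsto (fun n : ℕ => ⌈(1 + ε) * (n * Real.logb 2 n)⌉₊) atTop atTop := by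
  apply tendsto_nat_ceil_atTop.comp
  apply Tendsto.const_mul_atTop (by linarith)
  exact tendsto_natCast_atTop_atTop.atTop_mul_atTop₀ tendsto_logb_two_natCast_atTop

theorem eventually_le_mul_ceil_mul_logb {ε ν : ℝ} (hε : 0 < ε) (hν : 0 < ν) :
    ∀ᶠ n : ℕ in atTop, (n : ℝ) ≤ ν * ⌈(1 + ε) * (n * Real.logb 2 n)⌉₊ := by
  filter_upwards [tendsto_logb_two_natCast_atTop.eventually_ge_atTop (1 / ν)] with n hn
  have h1 := Nat.le_ceil ((1 + ε) * (n * Real.logb 2 n))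
  have h2 : 1 ≤ ν * Real.logb 2 n := by
    rw [div_le_iff₀ hν] at hn; linarith
  have hn0 : (0 : ℝ) ≤ n := Nat.cast_nonneg n
  have h3 : (n : ℝ) * 1 ≤ n * (ν * Real.logb 2 n) := mul_le_mul_of_nonneg_left h2 hn0
  have h4 : 0 ≤ ε * (n * (ν * Real.logb 2 n)) := mul_nonneg hε.le (by linarith)
  have h5 := mul_le_mul_of_nonneg_left h1 hν.le
  linarith

/-- Used to show that about `√k` vectors with `O(log k)` coordinates each cost `o(k)` bits. -/
theorem eventually_add_logb_le_mul_sqrt (C : ℝ) {ν : ℝ} (hν : 0 < ν) :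
    ∀ᶠ x : ℝ in atTop, C + 2 * Real.logb 2 x ≤ ν * √x := by
  have h1 : Tendsto (fun x : ℝ => √x) atTop atTop := Real.tendsto_sqrt_atTop
  have h2 := (isLittleO_log_rpow_atTop (show (0 : ℝ) < 1 / 2 by norm_num)).bound
    (show 0 < ν * Real.log 2 / 4 by have := Real.log_pos one_lt_two; positivity)
  filter_upwards [h1.eventually_ge_atTop (2 * C / ν), h2, eventually_ge_atTop 1] with x hx hx2 hx1
  have hlog2 := Real.log_pos one_lt_two
  rw [Real.norm_of_nonneg (Real.log_nonneg hx1), Real.norm_of_nonneg (by positivity),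
    ← Real.sqrt_eq_rpow] at hx2
  rw [div_le_iff₀ hν] at hx
  have h3 : Real.logb 2 x ≤ ν / 4 * √x := by
    rw [Real.logb, div_le_iff₀ hlog2]; linarith
  linarith

/-- Since `k ≤ n ^ (1 + η)` eventually, `log₂ k` exceeds `log₂ n` by a factor of at most `1 + η`.
The remaining ratio `(1 + η) / (1 + ε)` is the margin in the bounded `s` case. -/
theorem eventually_mul_logb_ceil_le {ε η : ℝ} (hε : 0 < ε) (hε1 : ε ≤ 1) (hη : 0 < η) :
    ∀ᶠ n : ℕ in atTop, (n : ℝ) * Real.logb 2 ⌈(1 + ε) * (n * Real.logb 2 n)⌉₊ ≤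
      (1 + η) / (1 + ε) * ⌈(1 + ε) * (n * Real.logb 2 n)⌉₊ := by
  have hlog2 := Real.log_pos one_lt_two
  have h2 := ((isLittleO_log_rpow_atTop hη).bound
    (show 0 < Real.log 2 / 3 by positivity)).natCast_atTop
  filter_upwards [h2, tendsto_logb_two_natCast_atTop.eventually_ge_atTop 1,
    eventually_ge_atTop 1] with n hn hL hn1
  have hn1' : (1 : ℝ) ≤ n := by exact_mod_cast hn1
  rw [Real.norm_of_nonneg (Real.log_nonneg hn1'), Real.norm_of_nonneg (by positivity)] at hn
  set k := ⌈(1 + ε) * (n * Real.logb 2 n)⌉₊ with hk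
  have hnL : 1 ≤ n * Real.logb 2 n := by nlinarith
  have hpos : 0 < (1 + ε) * (n * Real.logb 2 n) := by positivity
  have hle := Nat.le_ceil ((1 + ε) * (n * Real.logb 2 n))
  have hlt := Nat.ceil_lt_add_one hpos.le
  rw [← hk] at hle hlt
  have hkpos : (0 : ℝ) < k := lt_of_lt_of_le hpos hle
  have h3 : (k : ℝ) ≤ n ^ (1 + η) := by
    rw [Real.rpow_add (by linarith), Real.rpow_one]
    have h4 : 3 * Real.logb 2 n ≤ (n : ℝ) ^ η := by
      rw [Real.logb, ← mul_div_assoc, div_le_iff₀ hlog2]; linarith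
    have h5 : (n : ℝ) * (3 * Real.logb 2 n) ≤ n * (n : ℝ) ^ η :=
      mul_le_mul_of_nonneg_left h4 (by linarith)
    nlinarith
  have h6 : Real.logb 2 k ≤ (1 + η) * Real.logb 2 n := by
    rw [← Real.logb_rpow_eq_mul_logb_of_pos (by linarith)]
    exact Real.logb_le_logb_of_le (by norm_num) hkpos h3
  calc (n : ℝ) * Real.logb 2 k ≤ n * ((1 + η) * Real.logb 2 n) :=
        mul_le_mul_of_nonneg_left h6 (by linarith)
    _ = (1 + η) / (1 + ε) * ((1 + ε) * (n * Real.logb 2 n)) := by field_simp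
    _ ≤ _ := mul_le_mul_of_nonneg_left hle (by positivity)

/-- It makes `g s`, a small multiple of `s`, large enough to choose `k` triples out of a number
polynomial in `s` times `k`. -/
theorem eventually_mul_sq_le_two_pow_floor (C : ℝ) {c : ℝ} (hc : 0 < c) :
    ∀ᶠ s : ℕ in atTop, C * (s : ℝ) ^ 2 ≤ 2 ^ ⌊c * s⌋₊ := by
  have h1 : Tendsto (fun x : ℝ => x ^ (2 : ℝ) * Real.exp (-(c * Real.log 2) * x)) atTop (𝓝 0) :=
    tendsto_rpow_mul_exp_neg_mul_atTop_nhds_zero 2 _ (mul_pos hc (Real.log_pos one_lt_two))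
  have h2 := (h1.const_mul (2 * C)).comp tendsto_natCast_atTop_atTop
  rw [mul_zero] at h2
  filter_upwards [h2.eventually_lt_const one_pos] with s hs
  simp only [Function.comp_apply] at hs
  have h3 : (2 : ℝ) ^ (c * s) ≤ 2 * 2 ^ ⌊c * s⌋₊ := by
    rw [← pow_succ', ← Real.rpow_natCast]
    apply Real.rpow_le_rpow_of_exponent_le (by norm_num)
    push_cast
    exact (Nat.lt_floor_add_one _).le
  have h4 : Real.exp (-(c * Real.log 2) * s) * (2 : ℝ) ^ (c * s) = 1 := by
    rw [Real.rpow_def_of_pos (by norm_num), ← Real.exp_add]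
    convert Real.exp_zero using 2
    ring
  have h5 : (0 : ℝ) < 2 ^ (c * s) := by positivity
  have h6 : 2 * C * (s : ℝ) ^ 2 ≤ 2 ^ (c * s) := by
    rw [Real.rpow_two] at hs
    calc 2 * C * (s : ℝ) ^ 2 = 2 * C * ((s : ℝ) ^ 2 * Real.exp (-(c * Real.log 2) * s)) *
          2 ^ (c * s) := by
          rw [mul_assoc (2 * C), mul_assoc ((s : ℝ) ^ 2), h4, mul_one]
      _ ≤ 1 * 2 ^ (c * s) := mul_le_mul_of_nonneg_right hs.le h5.le
      _ = _ := one_mul _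
  linarith

theorem tendsto_mul_two_rpow_neg (C : ℝ) {a : ℝ} (ha : 0 < a) :
    Tendsto (fun x : ℝ => C * x * 2 ^ (1 - a * x)) atTop (𝓝 0) := by
  have h1 : Tendsto (fun x : ℝ => x ^ (1 : ℝ) * Real.exp (-(a * Real.log 2) * x)) atTop (𝓝 0) :=
    tendsto_rpow_mul_exp_neg_mul_atTop_nhds_zero 1 _ (mul_pos ha (Real.log_pos one_lt_two))
  have h2 := h1.const_mul (2 * C)
  rw [mul_zero] at h2
  refine h2.congr fun x => ?_
  rw [Real.rpow_one, Real.rpow_sub (by norm_num), Real.rpow_one, Real.rpow_def_of_pos (by norm_num),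
    show -(a * Real.log 2) * x = -(Real.log 2 * (a * x)) by ring, Real.exp_neg]
  field_simp

end Asymptotics

/-! ### Choice of parameters and the upper bound. -/

section UpperBound

/-- Bernoulli's inequality gives `2 ^ (1 - θ) ≤ 2 - θ`. -/
theorem le_floor_of_two_sub_pow_le {θ x : ℝ} (hθ0 : 0 ≤ θ) (hθ1 : θ < 1) (hx : 0 < x) {j : ℕ}
    (h : (2 - θ) ^ j ≤ x) : j ≤ ⌊Real.logb 2 x / (1 - θ)⌋₊ := by
  apply Nat.le_floor
  rw [le_div_iff₀ (by linarith), Real.le_logb_iff_rpow_le (by norm_num) hx]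
  refine le_trans ?_ h
  rw [mul_comm, Real.rpow_mul (by norm_num), Real.rpow_natCast]
  apply pow_le_pow_left₀ (by positivity)
  have := rpow_one_add_le_one_add_mul_self (s := 1) (by norm_num) (p := 1 - θ)
    (by linarith) (by linarith)
  norm_num at this
  linarith

/-- The main cost `n J` leaves `ε k / 8` of the gain unused, and the two lower-order costs take `ε k
/ 32` each. The value `θ = ε / 20` is small enough for this. -/
theorem sumset_code_exponent_le {ε n k L J s₀ m₀ : ℝ} (hε0 : 0 < ε) (hε1 : ε ≤ 1) (hn : 0 ≤ n)
    (hk : 0 ≤ k) (hm₀ : 0 ≤ m₀)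
    (hJ : J ≤ L / (1 - ε / 20)) (hJ2 : J ≤ 2 * L) (hnL : n * L ≤ (1 + ε / 4) / (1 + ε) * k)
    (hns : n * s₀ ≤ ε / 32 * k) (hmL : 2 * m₀ * (s₀ + 2 * L) ≤ ε / 32 * k) :
    (n + 2 * m₀) * (s₀ + J) - (1 - 4 * (ε / 20)) * k + 1 ≤ 1 - ε / 16 * k := by
  have h1 : n * J ≤ (1 - 4 * (ε / 20) - ε / 8) * k := by
    calc n * J ≤ n * (L / (1 - ε / 20)) := mul_le_mul_of_nonneg_left hJ hn
      _ = (n * L) / (1 - ε / 20) := by ring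
      _ ≤ ((1 + ε / 4) / (1 + ε) * k) / (1 - ε / 20) := by
        apply div_le_div_of_nonneg_right hnL (by linarith)
      _ = (1 + ε / 4) / ((1 + ε) * (1 - ε / 20)) * k := by
        have : 1 - ε / 20 ≠ 0 := by linarith
        field_simp
      _ ≤ _ := by
        apply mul_le_mul_of_nonneg_right _ hk
        have h2 : 0 < (1 + ε) * (1 - ε / 20) := mul_pos (by linarith) (by linarith)
        rw [div_le_iff₀ h2]
        nlinarith [mul_nonneg hε0.le (sub_nonneg.2 hε1), mul_pos hε0 hε0,
          mul_nonneg (mul_pos hε0 hε0).le (sub_nonneg.2 hε1)]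
  have h2 : 2 * m₀ * (s₀ + J) ≤ 2 * m₀ * (s₀ + 2 * L) :=
    mul_le_mul_of_nonneg_left (by linarith) (by linarith)
  nlinarith

/-- Six of the cost terms are at most `c k s / 16` each, and the remaining `4 k` is at most `c k s /
8` because `c s ≥ 32`. So half of the gain `c k s` survives. -/
theorem coveredSumset_code_exponent_le {c n k L J s m g : ℝ} (hc : 0 < c) (hn : 0 ≤ n) (hk : 0 < k)
    (hs : 1 ≤ s) (hm : 0 ≤ m) (hnk : n ≤ c / 32 * k) (hnL : n * L ≤ k) (hJ : J ≤ 2 * L)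
    (hg : g ≤ c / 16 * s) (hcs : 32 ≤ c * s) (hsk : s ≤ c / 32 * k) (hLk : 2 * L ≤ c / 16 * k)
    (hmk : m ≤ c / 128 * k) (hmL : m * L ≤ c / 128 * k * s) :
    (n + 4 * m + s) * (2 * s + J) + (g + 2) * k - c * k * s + 1 ≤ 1 - c / 2 * k := by
  have hs0 : 0 ≤ s := by linarith
  have h1 : n * s ≤ c / 32 * k * s := mul_le_mul_of_nonneg_right hnk hs0
  have h2 : n * J ≤ 2 * k := by
    have := mul_le_mul_of_nonneg_left hJ hn
    linarith
  have h3 : 32 * k ≤ c * s * k := mul_le_mul_of_nonneg_right hcs hk.le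
  have h4 : m * s ≤ c / 128 * k * s := mul_le_mul_of_nonneg_right hmk hs0
  have h5 : m * J ≤ m * (2 * L) := mul_le_mul_of_nonneg_left hJ hm
  have h6 : s * s ≤ c / 32 * k * s := mul_le_mul_of_nonneg_right hsk hs0
  have h7 : s * J ≤ s * (c / 16 * k) := mul_le_mul_of_nonneg_left (hJ.trans hLk) hs0
  have h8 : g * k ≤ c / 16 * s * k := mul_le_mul_of_nonneg_right hg hk.le
  have h9 : c / 2 * k * 1 ≤ c / 2 * k * s := mul_le_mul_of_nonneg_left hs (by positivity)
  linarith

theorem ceil_sqrt_mul_le {a x : ℝ} (ha : 0 ≤ a) (hx : 1 ≤ x) :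
    (⌈√(a * x)⌉₊ : ℝ) ≤ (√a + 1) * √x := by
  have h1 := (Nat.ceil_lt_add_one (Real.sqrt_nonneg (a * x))).le
  have h2 : 1 ≤ √x := Real.one_le_sqrt.2 hx
  have h3 : √(a * x) = √a * √x := Real.sqrt_mul ha x
  linarith

theorem le_ceil_sqrt_mul_self {a : ℝ} (ha : 0 ≤ a) : a ≤ (⌈√a⌉₊ : ℝ) * ⌈√a⌉₊ := by
  calc a = √a * √a := (Real.mul_self_sqrt ha).symm
    _ ≤ _ := mul_self_le_mul_self (Real.sqrt_nonneg _) (Nat.le_ceil _)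

set_option maxHeartbeats 2000000 in
/-- The clique number of the random Cayley graph is asymptotically almost surely less than
`(1 + ε) n log₂ n`. -/
theorem tendsto_measure_le_cliqueNum {Ω : ℕ → Type*} [∀ n, MeasurableSpace (Ω n)]
    (P : ∀ n, Measure (Ω n)) (A : ∀ n, Ω n → Set (Fin n → ZMod 2))
    (hA : ∀ n, IsRandomHalfSubset (P n) (A n)) {ε : ℝ} (hε0 : 0 < ε) (hε1 : ε ≤ 1) :
    Tendsto (fun n : ℕ => P n {ω : Ω n |
      (1 + ε) * (n * Real.logb 2 n) ≤ ((cayleySumGraph (A n ω)).cliqueNum : ℝ)})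
      atTop (𝓝 0) := by
  set θ : ℝ := ε / 20 with hθ
  have hθ0 : 0 < θ := by positivity
  have hθ1 : θ ≤ 1 / 20 := by rw [hθ]; linarith
  set c : ℝ := θ ^ 2 / 4 with hc
  have hc0 : 0 < c := by positivity
  have hθ2 : θ ^ 2 ≤ 1 / 20 * θ := by
    rw [sq]; exact mul_le_mul_of_nonneg_right hθ1 hθ0.le
  have hc1 : c ≤ 1 := by rw [hc]; linarith
  set l₀ : ℝ := -Real.log θ with hl₀
  have hl₀0 : 0 < l₀ := neg_pos.2 (Real.log_neg hθ0 (by linarith))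
  set l : ℝ := -Real.log (4 * θ ^ 2) with hl
  have hl0 : 0 < l := neg_pos.2 (Real.log_neg (by positivity) (by linarith))
  -- The threshold `s₀` depends on `ε` alone, so `n s₀` is negligible against `k`.
  obtain ⟨s₀, hs₀⟩ := eventually_atTop.1 ((eventually_mul_sq_le_two_pow_floor (32 * l)
    (show 0 < c / 16 by positivity)).and ((eventually_ge_atTop 1).and
    (tendsto_natCast_atTop_atTop.eventually_ge_atTop (32 / c))))
  have hs₀1 : 1 ≤ s₀ := (hs₀ s₀ le_rfl).2.1
  have hs₀r : (1 : ℝ) ≤ s₀ := by exact_mod_cast hs₀1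
  set k : ℕ → ℕ := fun n => ⌈(1 + ε) * (n * Real.logb 2 n)⌉₊ with hk
  have hktop : Tendsto k atTop atTop := tendsto_ceil_mul_logb_atTop hε0
  have hktopr : Tendsto (fun n => (k n : ℝ)) atTop atTop :=
    tendsto_natCast_atTop_atTop.comp hktop
  -- With `m₀ = ⌈√(a₀ k)⌉` the requirement `k s₀ (-log θ) ≤ θ m₀²` holds.
  set a₀ : ℝ := s₀ * l₀ / θ with ha₀
  have ha₀0 : 0 < a₀ := by positivity
  set D₀ : ℝ := √a₀ + 1 with hD₀
  have hD₀0 : 0 < D₀ := by positivity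
  set D : ℝ := √(2 * l) + 1 with hD
  have hD0 : 0 < D := by positivity
  have hlim : Tendsto (fun n => ENNReal.ofReal (3 * k n * 2 ^ (1 - c / 2 * (k n : ℝ))))
      atTop (𝓝 0) := by
    rw [← ENNReal.ofReal_zero]
    exact ENNReal.tendsto_ofReal
      ((tendsto_mul_two_rpow_neg 3 (show 0 < c / 2 by positivity)).comp hktopr)
  refine tendsto_of_tendsto_of_tendsto_of_le_of_le' tendsto_const_nhds hlim
    (Eventually.of_forall fun _ => zero_le) ?_
  filter_upwards [hktopr.eventually_ge_atTop 1,
    hktopr.eventually_ge_atTop (256 / c),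
    eventually_le_mul_ceil_mul_logb hε0 (show 0 < c ^ 2 / 256 by positivity),
    eventually_le_mul_ceil_mul_logb hε0 (show 0 < (c / 256) ^ 2 * c / (6 * l) by positivity),
    eventually_le_mul_ceil_mul_logb hε0 (show 0 < ε / 32 / s₀ by positivity),
    eventually_mul_logb_ceil_le hε0 hε1 (show 0 < ε / 4 by positivity),
    hktopr.eventually (eventually_add_logb_le_mul_sqrt s₀ (show 0 < ε / 64 / D₀ by positivity)),
    hktopr.eventually (eventually_add_logb_le_mul_sqrt 0 (show 0 < c / 64 / D by positivity)),
    hktopr.eventually (eventually_add_logb_le_mul_sqrt 0 (show 0 < c / 16 by positivity)),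
    eventually_ge_atTop 1]
    with n hk1 hkc hn1 hn2 hn3 hnL hL1 hL2 hL3 hnn
  change (n : ℝ) ≤ _ * (k n : ℝ) at hn1 hn2 hn3
  change (n : ℝ) * Real.logb 2 (k n) ≤ _ * (k n : ℝ) at hnL
  set L := Real.logb 2 (k n : ℝ) with hL
  set K : ℝ := (k n : ℝ) with hK
  have hnr : (1 : ℝ) ≤ n := by exact_mod_cast hnn
  have hK0 : 0 < K := by linarith
  have hL0 : 0 ≤ L := Real.logb_nonneg (by norm_num) hk1
  have hsqrtK : √K * √K = K := Real.mul_self_sqrt hK0.le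
  have hsqrt1 : 1 ≤ √K := Real.one_le_sqrt.2 hk1
  have hsqrtle : √K ≤ K := by
    have := mul_le_mul_of_nonneg_right hsqrt1 (Real.sqrt_nonneg K)
    rwa [one_mul, hsqrtK] at this
  set J := ⌊L / (1 - θ)⌋₊ with hJ
  have hJle : (J : ℝ) ≤ L / (1 - θ) := Nat.floor_le (div_nonneg hL0 (by linarith))
  have hJ2 : (J : ℝ) ≤ 2 * L := by
    refine hJle.trans ?_
    rw [div_le_iff₀ (by linarith)]
    have := mul_le_mul_of_nonneg_left (show 1 / 2 ≤ 1 - θ by linarith) hL0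
    linarith
  set m₀ := ⌈√(a₀ * K)⌉₊ with hm₀
  have hm₀le : (m₀ : ℝ) ≤ D₀ * √K := ceil_sqrt_mul_le ha₀0.le hk1
  have hm₀pos : 0 < m₀ := Nat.ceil_pos.2 (Real.sqrt_pos.2 (by positivity))
  have hDL : D₀ * (s₀ + 2 * L) ≤ ε / 64 * √K := by
    calc D₀ * (s₀ + 2 * L) ≤ D₀ * (ε / 64 / D₀ * √K) := mul_le_mul_of_nonneg_left hL1 hD₀0.le
      _ = _ := by field_simp
  have hm₀L : 2 * m₀ * (s₀ + 2 * L) ≤ ε / 32 * K := by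
    have h1 : (m₀ : ℝ) * (s₀ + 2 * L) ≤ D₀ * √K * (s₀ + 2 * L) :=
      mul_le_mul_of_nonneg_right hm₀le (by linarith)
    have h2 : √K * (D₀ * (s₀ + 2 * L)) ≤ √K * (ε / 64 * √K) :=
      mul_le_mul_of_nonneg_left hDL (Real.sqrt_nonneg _)
    have h3 : √K * (ε / 64 * √K) = ε / 64 * K := by
      rw [mul_left_comm, hsqrtK]
    linarith
  have hm₀k : (m₀ : ℝ) ≤ (1 - θ) * K := by
    have h1 : (m₀ : ℝ) * 1 ≤ m₀ * (s₀ + 2 * L) :=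
      mul_le_mul_of_nonneg_left (by linarith) (Nat.cast_nonneg _)
    have h2 : ε / 32 * K ≤ (1 - θ) * K := mul_le_mul_of_nonneg_right (by linarith) hK0.le
    linarith
  -- This makes the gain `c k s₁` at least twice the `n k` bits that describe `X` outright.
  set s₁ := ⌈2 / c * n⌉₊ with hs₁
  have hs₁le : (s₁ : ℝ) ≤ 3 / c * n := by
    have h1 := (Nat.ceil_lt_add_one (show 0 ≤ 2 / c * (n : ℝ) by positivity)).le
    have h2 : 1 ≤ 1 / c * n := by
      rw [one_div, inv_mul_eq_div, le_div_iff₀ hc0]; linarith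
    have h3 : 3 / c * (n : ℝ) = 2 / c * n + 1 / c * n := by ring
    rw [h3]; linarith
  have hs₁K : (s₁ : ℝ) ≤ c / 32 * K := by
    calc (s₁ : ℝ) ≤ 3 / c * n := hs₁le
      _ ≤ 3 / c * (c ^ 2 / 256 * K) := mul_le_mul_of_nonneg_left hn1 (by positivity)
      _ = c * 3 / 256 * K := by field_simp
      _ ≤ _ := mul_le_mul_of_nonneg_right (by linarith) hK0.le
  -- The least size allowed by the covering lemma. It is a small fraction of `k` since `s < s₁ =
  -- O(n)` and `n = o(k)`.
  set m : ℕ → ℕ := fun s => ⌈√(2 * l * (K * s))⌉₊ with hm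
  set g : ℕ → ℕ := fun s => ⌊c / 16 * s⌋₊ with hg
  have hKs : ∀ s, s₀ ≤ s → 1 ≤ K * (s : ℝ) := by
    intro s hs
    have h1 : (1 : ℝ) ≤ s := by exact_mod_cast hs₀1.trans hs
    exact one_le_mul_of_one_le_of_one_le hk1 h1
  have hmle : ∀ s, s₀ ≤ s → (m s : ℝ) ≤ D * √(K * s) := fun s hs =>
    ceil_sqrt_mul_le (by positivity) (hKs s hs)
  have hmK : ∀ s, s₀ ≤ s → s < s₁ → (m s : ℝ) ≤ c / 128 * K := by
    intro s hs hss
    have h1 := (Nat.ceil_lt_add_one (Real.sqrt_nonneg (2 * l * (K * s)))).le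
    have h2 : √(2 * l * (K * s)) ≤ c / 256 * K := by
      apply Real.sqrt_le_iff.2 ⟨by positivity, ?_⟩
      have h3 : (s : ℝ) ≤ s₁ := by exact_mod_cast hss.le
      have h4 : (s : ℝ) ≤ 3 / c * ((c / 256) ^ 2 * c / (6 * l) * K) :=
        h3.trans (hs₁le.trans (mul_le_mul_of_nonneg_left hn2 (by positivity)))
      have h5 : 3 / c * ((c / 256) ^ 2 * c / (6 * l) * K) = (c / 256) ^ 2 / (2 * l) * K := by
        field_simp; norm_num
      rw [h5] at h4
      calc 2 * l * (K * s) ≤ 2 * l * (K * ((c / 256) ^ 2 / (2 * l) * K)) := by gcongr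
        _ = (c / 256 * K) ^ 2 := by field_simp
    have h6 : 1 ≤ c / 256 * K := by
      rw [div_le_iff₀ hc0] at hkc
      linarith
    simp only [hm]
    linarith
  have hmL : ∀ s, s₀ ≤ s → (m s : ℝ) * L ≤ c / 128 * K * s := by
    intro s hs
    have hs1 : (1 : ℝ) ≤ s := by exact_mod_cast hs₀1.trans hs
    have h1 : √(K * s) ≤ √K * s := by
      rw [Real.sqrt_mul hK0.le]
      apply mul_le_mul_of_nonneg_left _ (Real.sqrt_nonneg _)
      exact Real.sqrt_le_iff.2 ⟨by linarith, le_self_pow₀ hs1 two_ne_zero⟩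
    have h2 : D * L ≤ c / 128 * √K := by
      have h3 : D * (0 + 2 * L) ≤ D * (c / 64 / D * √K) := mul_le_mul_of_nonneg_left hL2 hD0.le
      have h4 : D * (c / 64 / D * √K) = c / 64 * √K := by field_simp
      linarith
    calc (m s : ℝ) * L ≤ D * (√K * s) * L := by
          apply mul_le_mul_of_nonneg_right _ hL0
          exact (hmle s hs).trans (mul_le_mul_of_nonneg_left h1 hD0.le)
      _ = (√K * s) * (D * L) := by ring
      _ ≤ (√K * s) * (c / 128 * √K) := mul_le_mul_of_nonneg_left h2 (by positivity)
      _ = c / 128 * (√K * √K) * s := by ring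
      _ = _ := by rw [hsqrtK]
  have hset : {ω : Ω n | (1 + ε) * (n * Real.logb 2 n) ≤
      ((cayleySumGraph (A n ω)).cliqueNum : ℝ)} = {ω | k n ≤ (cayleySumGraph (A n ω)).cliqueNum} := by
    ext ω
    simp only [Set.mem_ofPred_eq, hk, Nat.ceil_le]
  rw [hset]
  have hkpos : 0 < k n := by
    have : (0 : ℝ) < k n := hK0
    exact_mod_cast this
  refine ((hA n).measure_le_cliqueNum_le (n := n) (by simp) hkpos hθ0 (by linarith)
    (s₀ := s₀) (s₁ := s₁) (J := J) (m₀ := m₀) m g hs₀1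
    (fun j hj => le_floor_of_two_sub_pow_le hθ0.le (by linarith) hK0 hj) hm₀pos hm₀k ?_ ?_ ?_).trans ?_
  · have h1 := le_ceil_sqrt_mul_self (show 0 ≤ a₀ * K by positivity)
    calc (k n : ℝ) * s₀ * (-Real.log θ) = θ * (a₀ * K) := by
          rw [ha₀, ← hl₀]; field_simp; rfl
      _ ≤ θ * (m₀ * m₀) := mul_le_mul_of_nonneg_left h1 hθ0.le
      _ = _ := by ring
  · intro s hs hss
    have hKs1 := hKs s hs
    refine ⟨Nat.ceil_pos.2 (Real.sqrt_pos.2 (by positivity)), ?_, ?_⟩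
    · have h1 := hmK s hs hss
      have h2 : 2 * (m s : ℝ) ≤ (k n : ℝ) := by
        have h3 : c / 128 * K ≤ 1 / 2 * K := mul_le_mul_of_nonneg_right (by linarith) hK0.le
        linarith
      exact_mod_cast h2
    · have h1 := le_ceil_sqrt_mul_self (show 0 ≤ 2 * l * (K * s) by positivity)
      refine le_trans (le_of_eq ?_) h1
      rw [← hl]; ring
  · intro s hs hss
    have h1 := (hs₀ s hs).1
    have hKs1 := hKs s hs
    have h2 : (m s : ℝ) ≤ 2 * √(2 * l * (K * s)) := by
      have h3 := (Nat.ceil_lt_add_one (Real.sqrt_nonneg (2 * l * (K * s)))).le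
      have h4 : 1 ≤ √(2 * l * (K * s)) := by
        apply Real.one_le_sqrt.2
        have h5 : 1 ≤ 2 * l := by
          have h6 : (4 * θ ^ 2) ≤ Real.exp (-1) := by
            rw [Real.exp_neg]
            have h7 : (3 : ℝ)⁻¹ ≤ (Real.exp 1)⁻¹ :=
              inv_anti₀ (Real.exp_pos 1) (by linarith [Real.exp_one_lt_d9])
            linarith
          have h8 := Real.log_le_log (by positivity) h6
          rw [Real.log_exp] at h8
          linarith
        exact one_le_mul_of_one_le_of_one_le h5 hKs1
      simp only [hm]
      linarith
    have h5 : (m s : ℝ) * m s ≤ 4 * (2 * l * (K * s)) := by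
      have h6 : √(2 * l * (K * s)) * √(2 * l * (K * s)) = 2 * l * (K * s) :=
        Real.mul_self_sqrt (by positivity)
      have h7 := mul_self_le_mul_self (Nat.cast_nonneg (m s)) h2
      linarith
    have h8 : 2 * (m s : ℝ) * (2 * m s * s) ≤ 2 ^ g s * (k n : ℝ) := by
      calc 2 * (m s : ℝ) * (2 * m s * s) = 4 * s * (m s * m s) := by ring
        _ ≤ 4 * s * (4 * (2 * l * (K * s))) := mul_le_mul_of_nonneg_left h5 (by positivity)
        _ = 32 * l * (s : ℝ) ^ 2 * K := by ring
        _ ≤ _ := mul_le_mul_of_nonneg_right h1 hK0.le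
    exact_mod_cast h8
  · have hb : ∀ x : ℝ, x ≤ 1 - c / 2 * K →
        ENNReal.ofReal (2 ^ x) ≤ ENNReal.ofReal (2 ^ (1 - c / 2 * K)) := fun x hx =>
      ENNReal.ofReal_le_ofReal (Real.rpow_le_rpow_of_exponent_le (by norm_num) hx)
    have hcε : c / 2 ≤ ε / 16 := by rw [hc]; linarith
    have e₁ : ((n : ℝ) + 2 * m₀) * (s₀ + J) - (1 - 4 * θ) * K + 1 ≤ 1 - c / 2 * K := by
      have h1 := sumset_code_exponent_le (n := n) (k := K) (L := L) (J := J) (s₀ := s₀) (m₀ := m₀)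
        hε0 hε1 (Nat.cast_nonneg _) hK0.le (Nat.cast_nonneg _) hJle hJ2 hnL (by
          have := mul_le_mul_of_nonneg_right hn3 (show (0 : ℝ) ≤ s₀ by positivity)
          refine this.trans (le_of_eq ?_)
          field_simp) hm₀L
      have h2 : c / 2 * K ≤ ε / 16 * K := mul_le_mul_of_nonneg_right hcε hK0.le
      rw [← hθ] at h1
      linarith
    have hnLK : n * L ≤ K := by
      refine hnL.trans ?_
      have : (1 + ε / 4) / (1 + ε) ≤ 1 := by rw [div_le_one (by linarith)]; linarith
      exact (mul_le_mul_of_nonneg_right this hK0.le).trans (one_mul K).le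
    have e₂ : ∀ s ∈ Finset.Ico s₀ s₁, ((n : ℝ) + 4 * m s + s) * (2 * s + J) + (g s + 2) * K -
        c * K * s + 1 ≤ 1 - c / 2 * K := by
      intro s hs
      obtain ⟨hs, hss⟩ := Finset.mem_Ico.1 hs
      have hsr : (s : ℝ) ≤ s₁ := by exact_mod_cast hss.le
      refine coveredSumset_code_exponent_le (L := L) hc0 (Nat.cast_nonneg _) hK0
        (by exact_mod_cast hs₀1.trans hs) (Nat.cast_nonneg _) ?_ hnLK hJ2
        (Nat.floor_le (by positivity)) ?_ (hsr.trans hs₁K) ?_ (hmK s hs hss) (hmL s hs)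
      · refine hn1.trans (mul_le_mul_of_nonneg_right ?_ hK0.le)
        have := mul_le_mul_of_nonneg_left hc1 hc0.le
        linarith
      · have := (hs₀ s hs).2.2
        rw [div_le_iff₀ hc0] at this
        linarith
      · have : c / 16 * √K ≤ c / 16 * K := mul_le_mul_of_nonneg_left hsqrtle (by positivity)
        linarith
    have e₃ : (n : ℝ) * K - c * K * s₁ + 1 ≤ 1 - c / 2 * K := by
      have h1 := Nat.le_ceil (2 / c * (n : ℝ))
      have h2 : c * K * (2 / c * n) ≤ c * K * s₁ := mul_le_mul_of_nonneg_left h1 (by positivity)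
      have h3 : c * K * (2 / c * n) = 2 * (n * K) := by field_simp
      have h4 : 1 * K ≤ n * K := mul_le_mul_of_nonneg_right hnr hK0.le
      have h5 : c / 2 * K ≤ 1 * K := mul_le_mul_of_nonneg_right (by linarith) hK0.le
      linarith
    refine (add_le_add (add_le_add (hb _ e₁) (Finset.sum_le_sum fun s hs => hb _ (e₂ s hs)))
      (hb _ e₃)).trans ?_
    rw [Finset.sum_const, Nat.card_Ico, nsmul_eq_mul, ← ENNReal.ofReal_natCast,
      ← ENNReal.ofReal_mul (Nat.cast_nonneg _), ← ENNReal.ofReal_add (by positivity) (by positivity),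
      ← ENNReal.ofReal_add (by positivity) (by positivity)]
    apply ENNReal.ofReal_le_ofReal
    -- There are `2 + (s₁ - s₀) ≤ 3 k` terms, each at most `2 ^ (1 - c k / 2)`.
    have h1 : ((s₁ - s₀ : ℕ) : ℝ) ≤ K := by
      have h2 : ((s₁ - s₀ : ℕ) : ℝ) ≤ s₁ := by exact_mod_cast Nat.sub_le _ _
      have h3 : c / 32 * K ≤ 1 * K := mul_le_mul_of_nonneg_right (by linarith) hK0.le
      linarith
    have h4 : (0 : ℝ) ≤ 2 ^ (1 - c / 2 * K) := by positivity
    calc _ = (2 + ((s₁ - s₀ : ℕ) : ℝ)) * 2 ^ (1 - c / 2 * K) := by ring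
      _ ≤ 3 * K * 2 ^ (1 - c / 2 * K) := mul_le_mul_of_nonneg_right (by linarith) h4

end UpperBound

/-! ### Kernels of linear maps over `𝔽₂` and the second moment inequality. -/

section SecondMoment

open scoped Classical

theorem card_linearMap_zmod_two (U W : Type*) [AddCommGroup U] [AddCommGroup W]
    [Module (ZMod 2) U] [Module (ZMod 2) W] [Finite U] [Finite W] :
    Nat.card (U →ₗ[ZMod 2] W) =
      2 ^ (Module.finrank (ZMod 2) U * Module.finrank (ZMod 2) W) := by
  have := Fintype.ofFinite U
  have := Fintype.ofFinite W
  have : Finite (U →ₗ[ZMod 2] W) := DFunLike.finite _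
  have := Fintype.ofFinite (U →ₗ[ZMod 2] W)
  rw [Nat.card_eq_fintype_card, Module.card_eq_pow_finrank (K := ZMod 2), ZMod.card,
    Module.finrank_linearMap]

/-- Maps vanishing on `K` factor through the quotient by `K`. -/
theorem card_linearMap_le_ker_le {U W : Type*} [AddCommGroup U] [AddCommGroup W]
    [Module (ZMod 2) U] [Module (ZMod 2) W] [Finite U] [Finite W] (K : Submodule (ZMod 2) U) :
    Nat.card {N : U →ₗ[ZMod 2] W // K ≤ LinearMap.ker N} ≤
      2 ^ ((Module.finrank (ZMod 2) U - Module.finrank (ZMod 2) K) *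
        Module.finrank (ZMod 2) W) := by
  have : Finite (U ⧸ K) := Finite.of_surjective _ K.mkQ_surjective
  have : Finite (U ⧸ K →ₗ[ZMod 2] W) := DFunLike.finite _
  have h1 := Nat.card_le_card_of_injective
    (fun N : {N : U →ₗ[ZMod 2] W // K ≤ LinearMap.ker N} => K.liftQ N.1 N.2) (by
      intro N N' h
      apply Subtype.ext
      have h2 := congrArg (fun f => f ∘ₗ K.mkQ) h
      simpa only [Submodule.liftQ_mkQ] using h2)
  rw [card_linearMap_zmod_two] at h1
  have h3 := Submodule.finrank_quotient_add_finrank K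
  rwa [show Module.finrank (ZMod 2) U - Module.finrank (ZMod 2) K =
    Module.finrank (ZMod 2) (U ⧸ K) by omega]

/-- Bound for the number of linear maps over `𝔽₂` with kernel of dimension `i`. -/
theorem card_linearMap_finrank_ker_eq_le {U W : Type*} [AddCommGroup U] [AddCommGroup W]
    [Module (ZMod 2) U] [Module (ZMod 2) W] [Fintype U] [Fintype W] [Fintype (U →ₗ[ZMod 2] W)]
    (i : ℕ) :
    (Finset.univ.filter fun N : U →ₗ[ZMod 2] W =>
        Module.finrank (ZMod 2) (LinearMap.ker N) = i).card ≤
      2 ^ (Module.finrank (ZMod 2) U * i) *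
        2 ^ ((Module.finrank (ZMod 2) U - i) * Module.finrank (ZMod 2) W) := by
  -- A kernel of dimension `i` is spanned by one of at most `|U| ^ i` tuples, and each such tuple
  -- leaves `2 ^ ((d - i) e)` maps, where `d = dim U` and `e = dim W`.
  set T : Finset (Fin i → U) := Finset.univ.filter fun v =>
    Module.finrank (ZMod 2) (Submodule.span (ZMod 2) (Set.range v)) = i
  have hsub : (Finset.univ.filter fun N : U →ₗ[ZMod 2] W =>
        Module.finrank (ZMod 2) (LinearMap.ker N) = i) ⊆
      T.biUnion fun v => Finset.univ.filter fun N =>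
        Submodule.span (ZMod 2) (Set.range v) ≤ LinearMap.ker N := by
    intro N hN
    have hN' := (Finset.mem_filter.1 hN).2
    set b := Module.finBasisOfFinrankEq (ZMod 2) (LinearMap.ker N) hN'
    have hspan : Submodule.span (ZMod 2) (Set.range fun l => (b l : U)) = LinearMap.ker N := by
      have h1 : (Set.range fun l => (b l : U)) = (LinearMap.ker N).subtype '' Set.range b := by
        rw [← Set.range_comp]; rfl
      rw [h1, ← Submodule.map_span, b.span_eq, Submodule.map_subtype_top]
    refine Finset.mem_biUnion.2 ⟨fun l => (b l : U), ?_, ?_⟩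
    · refine Finset.mem_filter.2 ⟨Finset.mem_univ _, ?_⟩
      rw [hspan]; exact hN'
    · refine Finset.mem_filter.2 ⟨Finset.mem_univ _, ?_⟩
      rw [hspan]
  refine (Finset.card_le_card hsub).trans ((Finset.card_biUnion_le_card_mul _ _ _ ?_).trans
    (Nat.mul_le_mul_right (2 ^ ((Module.finrank (ZMod 2) U - i) * Module.finrank (ZMod 2) W)) ?_))
  · intro v hv
    have h1 := card_linearMap_le_ker_le (W := W) (Submodule.span (ZMod 2) (Set.range v))
    rw [(Finset.mem_filter.1 hv).2, Nat.card_eq_fintype_card, Fintype.card_subtype] at h1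
    exact h1
  · refine (Finset.card_le_univ _).trans ?_
    rw [Fintype.card_fun, Fintype.card_fin, Module.card_eq_pow_finrank (K := ZMod 2) (V := U),
      ZMod.card, ← pow_mul]

/-- Equivalently, `2 ^ i / i` is nondecreasing, which bounds every kernel dimension by the extreme
case `i = d`. -/
theorem mul_two_pow_le_mul_two_pow {i d : ℕ} (hi : 1 ≤ i) (hid : i ≤ d) :
    d * 2 ^ i ≤ i * 2 ^ d := by
  induction d, hid using Nat.le_induction with
  | base => exact le_rfl
  | succ d hd ih =>
    have h1 : 2 ^ i ≤ i * 2 ^ d := by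
      calc 2 ^ i ≤ 2 ^ d := Nat.pow_le_pow_right (by norm_num) hd
        _ ≤ i * 2 ^ d := Nat.le_mul_of_pos_left _ hi
    calc (d + 1) * 2 ^ i = d * 2 ^ i + 2 ^ i := by ring
      _ ≤ i * 2 ^ d + i * 2 ^ d := add_le_add ih h1
      _ = _ := by ring

/-- The average of `2 ^ (|ker N| - 1)` over all linear maps `N` is close to `1`. -/
theorem sum_two_pow_card_ker_le {U W : Type*} [AddCommGroup U] [AddCommGroup W]
    [Module (ZMod 2) U] [Module (ZMod 2) W] [Fintype U] [Fintype W] [Fintype (U →ₗ[ZMod 2] W)]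
    {d e : ℕ} (hd : Module.finrank (ZMod 2) U = d) (he : Module.finrank (ZMod 2) W = e)
    (hd0 : 0 < d) {x : ℝ} (hx0 : 0 ≤ x) (hx : x ≤ e - d - 2 ^ d / d) :
    ∑ N : U →ₗ[ZMod 2] W, (2 : ℝ) ^ (Nat.card (LinearMap.ker N) - 1) ≤
      (1 + d * 2 ^ (-x)) * 2 ^ (d * e) := by
  have hd0' : (0 : ℝ) < d := by exact_mod_cast hd0
  have hfr : ∀ N : U →ₗ[ZMod 2] W, Module.finrank (ZMod 2) (LinearMap.ker N) ∈
      Finset.range (d + 1) := fun N => by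
    rw [Finset.mem_range, Nat.lt_succ_iff, ← hd]
    exact Submodule.finrank_le _
  have hcard : ∀ N : U →ₗ[ZMod 2] W, Nat.card (LinearMap.ker N) =
      2 ^ Module.finrank (ZMod 2) (LinearMap.ker N) := fun N => by
    have := Fintype.ofFinite (LinearMap.ker N)
    rw [Nat.card_eq_fintype_card, Module.card_eq_pow_finrank (K := ZMod 2), ZMod.card]
  rw [← Finset.sum_fiberwise_of_maps_to (fun N _ => hfr N)]
  have hinner : ∀ i ∈ Finset.range (d + 1), ∑ N : U →ₗ[ZMod 2] W with
      Module.finrank (ZMod 2) (LinearMap.ker N) = i, (2 : ℝ) ^ (Nat.card (LinearMap.ker N) - 1) ≤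
      (2 : ℝ) ^ (d * i) * 2 ^ ((d - i) * e) * 2 ^ (2 ^ i - 1) := by
    intro i _
    have h1 := card_linearMap_finrank_ker_eq_le (U := U) (W := W) i
    rw [hd, he] at h1
    rw [Finset.sum_congr rfl (g := fun _ => (2 : ℝ) ^ (2 ^ i - 1)) (fun N hN => by
      rw [hcard, (Finset.mem_filter.1 hN).2]), Finset.sum_const, nsmul_eq_mul]
    apply mul_le_mul_of_nonneg_right _ (by positivity)
    exact_mod_cast h1
  -- Relative to `2 ^ (d e)`, kernel dimension `i ≥ 1` has exponent at most `-i (e - d - 2 ^ d / d)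
  -- ≤ -x`. Dimension `0` supplies the main term `1`.
  have hterm : ∀ i ∈ Finset.range d,
      (2 : ℝ) ^ (d * (i + 1)) * 2 ^ ((d - (i + 1)) * e) * 2 ^ (2 ^ (i + 1) - 1) ≤
        2 ^ (-x) * 2 ^ (d * e) := by
    intro i hi
    have hid : i + 1 ≤ d := Finset.mem_range.1 hi
    have h1 := mul_two_pow_le_mul_two_pow (Nat.le_add_left 1 i) hid
    have h1' : (d : ℝ) * 2 ^ (i + 1) ≤ ((i : ℝ) + 1) * 2 ^ d := by exact_mod_cast h1
    have h2 : (2 : ℝ) ^ (i + 1) ≤ ((i : ℝ) + 1) * (2 ^ d / d) := by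
      rw [← mul_div_assoc, le_div_iff₀ hd0']; linarith
    rw [← Real.rpow_natCast 2 (d * (i + 1)), ← Real.rpow_natCast 2 ((d - (i + 1)) * e),
      ← Real.rpow_natCast 2 (2 ^ (i + 1) - 1), ← Real.rpow_natCast 2 (d * e),
      ← Real.rpow_add (by norm_num), ← Real.rpow_add (by norm_num), ← Real.rpow_add (by norm_num)]
    apply Real.rpow_le_rpow_of_exponent_le (by norm_num)
    push_cast [Nat.cast_sub hid, Nat.cast_sub (Nat.one_le_two_pow (n := i + 1))]
    have h3 : x * 1 ≤ (e - d - 2 ^ d / d) * (i + 1) :=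
      mul_le_mul hx (by linarith [(Nat.cast_nonneg i : (0 : ℝ) ≤ i)]) zero_le_one
        (hx0.trans hx)
    linarith
  calc _ ≤ ∑ i ∈ Finset.range (d + 1),
        (2 : ℝ) ^ (d * i) * 2 ^ ((d - i) * e) * 2 ^ (2 ^ i - 1) := Finset.sum_le_sum hinner
    _ = ∑ i ∈ Finset.range d,
        (2 : ℝ) ^ (d * (i + 1)) * 2 ^ ((d - (i + 1)) * e) * 2 ^ (2 ^ (i + 1) - 1) +
          2 ^ (d * e) := by
      rw [Finset.sum_range_succ']; simp
    _ ≤ ∑ i ∈ Finset.range d, (2 : ℝ) ^ (-x) * 2 ^ (d * e) + 2 ^ (d * e) :=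
      add_le_add (Finset.sum_le_sum hterm) le_rfl
    _ = _ := by rw [Finset.sum_const, Finset.card_range, nsmul_eq_mul]; ring

/-- Second moment method for a finite family of events of equal probability. -/
theorem two_sub_le_measureReal_iUnion {Ω ι : Type*} [MeasurableSpace Ω] {P : Measure Ω}
    [IsProbabilityMeasure P] [Fintype ι] {E : ι → Set Ω} (hE : ∀ i, MeasurableSet (E i)) {p : ℝ}
    (hp : ∀ i, P.real (E i) = p) (hp0 : p ≠ 0) [Nonempty ι] :
    2 - (∑ i, ∑ j, P.real (E i ∩ E j)) / (Fintype.card ι * p) ^ 2 ≤ P.real (⋃ i, E i) := by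
  set t : ℝ := (Fintype.card ι * p)⁻¹ with ht
  have hN : (Fintype.card ι : ℝ) ≠ 0 := by exact_mod_cast Fintype.card_ne_zero
  set f : ι → Ω → ℝ := fun i => (E i).indicator 1 with hf
  have hint : ∀ S : Set Ω, MeasurableSet S → Integrable (S.indicator (1 : Ω → ℝ)) P := fun S hS =>
    (integrable_const (1 : ℝ)).indicator hS
  have hint2 : ∀ S : Set Ω, MeasurableSet S → ∫ ω, S.indicator (1 : Ω → ℝ) ω ∂P = P.real S :=
    fun S hS => integral_indicator_one hS
  -- With `N` the number of events that occur and `t = 1 / E[N]`, the inequality is `2 t N - (t N)²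
  -- ≤ 1`, with left side `0` when `N = 0`. Integration gives `2 - E[N²] / E[N]²`.
  have hpt : ∀ ω, 2 * t * ∑ i, f i ω - t ^ 2 * ∑ i, ∑ j, (E i ∩ E j).indicator (1 : Ω → ℝ) ω ≤
      (⋃ i, E i).indicator (1 : Ω → ℝ) ω := by
    intro ω
    have h1 : ∑ i, ∑ j, (E i ∩ E j).indicator (1 : Ω → ℝ) ω = (∑ i, f i ω) ^ 2 := by
      rw [sq, Finset.sum_mul_sum]
      refine Finset.sum_congr rfl fun i _ => Finset.sum_congr rfl fun j _ => ?_
      rw [Set.inter_indicator_one]; rfl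
    rw [h1]
    by_cases hω : ω ∈ ⋃ i, E i
    · rw [Set.indicator_of_mem hω, Pi.one_apply]
      nlinarith [sq_nonneg (t * ∑ i, f i ω - 1)]
    · rw [Set.indicator_of_notMem hω]
      have : ∑ i, f i ω = 0 := Finset.sum_eq_zero fun i _ =>
        Set.indicator_of_notMem (fun h => hω (Set.mem_iUnion.2 ⟨i, h⟩)) _
      simp [this]
  have hi1 : Integrable (fun ω => 2 * t * ∑ i, f i ω) P :=
    (integrable_finsetSum _ fun i _ => hint _ (hE i)).const_mul _
  have hi2 : Integrable (fun ω => t ^ 2 * ∑ i, ∑ j, (E i ∩ E j).indicator (1 : Ω → ℝ) ω) P :=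
    (integrable_finsetSum _ fun i _ => integrable_finsetSum _ fun j _ =>
      hint _ ((hE i).inter (hE j))).const_mul _
  have h2 := integral_mono (hi1.sub hi2) (hint _ (MeasurableSet.iUnion hE)) hpt
  rw [hint2 _ (MeasurableSet.iUnion hE)] at h2
  simp only [Pi.sub_apply] at h2
  rw [integral_sub hi1 hi2, integral_const_mul, integral_const_mul,
    integral_finsetSum _ (fun i _ => hint _ (hE i)),
    integral_finsetSum _ (fun i _ => integrable_finsetSum _ fun j _ =>
      hint _ ((hE i).inter (hE j)))] at h2
  simp only [integral_finsetSum _ (fun j _ => hint _ ((hE _).inter (hE j)))] at h2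
  simp only [hint2 _ (hE _), hint2 _ ((hE _).inter (hE _)), hp, Finset.sum_const,
    Finset.card_univ, nsmul_eq_mul] at h2
  refine le_trans (le_of_eq ?_) h2
  rw [mul_assoc 2 t, ht, inv_mul_cancel₀ (mul_ne_zero hN hp0), inv_pow]
  ring

end SecondMoment

/-! ### Graphs of linear maps as cliques, and the lower bound. -/

section LowerBound

open scoped Classical

/-- Lower bound for the probability that a random set contains the nonzero elements of the graph of
some linear map `U → W`. -/
theorem IsRandomHalfSubset.le_measureReal_two_pow_le_cliqueNum {U W V : Type*} [AddCommGroup U]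
    [AddCommGroup W] [AddCommGroup V] [Module (ZMod 2) U] [Module (ZMod 2) W] [Module (ZMod 2) V]
    [Fintype U] [Fintype W] (φ : (U × W) ≃ₗ[ZMod 2] V) {Ω : Type*} [MeasurableSpace Ω]
    {P : Measure Ω} [IsProbabilityMeasure P] {A : Ω → Set V} (hA : IsRandomHalfSubset P A)
    {d e : ℕ} (hd : Module.finrank (ZMod 2) U = d) (he : Module.finrank (ZMod 2) W = e)
    (hd0 : 0 < d) {x : ℝ} (hx0 : 0 ≤ x) (hx : x ≤ e - d - 2 ^ d / d) :
    1 - d * 2 ^ (-x) ≤ P.real {ω | 2 ^ d ≤ (cayleySumGraph (A ω)).cliqueNum} := by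
  have : Finite (U →ₗ[ZMod 2] W) := DFunLike.finite _
  have := Fintype.ofFinite (U →ₗ[ZMod 2] W)
  have hcardU : Fintype.card U = 2 ^ d := by
    rw [Module.card_eq_pow_finrank (K := ZMod 2) (V := U), ZMod.card, hd]
  have hcardN : Fintype.card (U →ₗ[ZMod 2] W) = 2 ^ (d * e) := by
    rw [← Nat.card_eq_fintype_card, card_linearMap_zmod_two, hd, he]
  have hinj : ∀ M : U →ₗ[ZMod 2] W, Function.Injective fun u => φ (u, M u) := fun M u u' h =>
    congrArg Prod.fst (φ.injective h)
  set U₀ : Finset U := Finset.univ.erase 0 with hU₀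
  set S : (U →ₗ[ZMod 2] W) → Finset V := fun M => U₀.image fun u => φ (u, M u) with hS
  set q : ℕ := 2 ^ d - 1 with hq
  have hScard : ∀ M, (S M).card = q := fun M => by
    rw [hS]
    simp only
    rw [Finset.card_image_of_injective _ (hinj M), hU₀, Finset.card_erase_of_mem (Finset.mem_univ _),
      Finset.card_univ, hcardU]
  -- The graphs of `M` and `M'` agree exactly over `ker (M - M')`, and `0` is removed.
  have hinter : ∀ M M', (S M ∩ S M').card = Nat.card (LinearMap.ker (M - M')) - 1 := by
    intro M M'
    have h1 : S M ∩ S M' = ((Finset.univ.filter fun u : U => u ∈ LinearMap.ker (M - M')).erase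
        0).image fun u => φ (u, M u) := by
      ext v
      simp only [hS, hU₀, Finset.mem_inter, Finset.mem_image, Finset.mem_erase, Finset.mem_filter,
        Finset.mem_univ, true_and, and_true, LinearMap.mem_ker, LinearMap.sub_apply, sub_eq_zero]
      constructor
      · rintro ⟨⟨u, hu, rfl⟩, u', hu', h⟩
        have h2 := φ.injective h
        obtain rfl : u' = u := congrArg Prod.fst h2
        exact ⟨u', ⟨hu, (congrArg Prod.snd h2).symm⟩, rfl⟩
      · rintro ⟨u, ⟨hu, h⟩, rfl⟩
        exact ⟨⟨u, hu, rfl⟩, u, hu, by rw [h]⟩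
    rw [h1, Finset.card_image_of_injective _ (hinj M), Finset.card_erase_of_mem (by simp),
      Nat.card_eq_fintype_card, Fintype.card_subtype]
  set E : (U →ₗ[ZMod 2] W) → Set Ω := fun M => {ω | ∀ v ∈ S M, v ∈ A ω} with hE
  have hmeas : ∀ M, MeasurableSet (E M) := fun M => by
    have h1 : E M = ⋂ v ∈ S M, {ω | v ∈ A ω} := by ext; simp [hE]
    rw [h1]
    exact Finset.measurableSet_biInter _ fun v _ => hA.measurableSet_mem v
  have hreal : ∀ T : Finset V, P.real {ω | ∀ v ∈ T, v ∈ A ω} = 2 ^ (-(T.card : ℝ)) := fun T => by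
    rw [measureReal_def, hA.measure_forall_mem, ENNReal.toReal_ofReal (by positivity)]
  set p : ℝ := 2 ^ (-(q : ℝ)) with hp
  have hp0 : 0 < p := by positivity
  have hpE : ∀ M, P.real (E M) = p := fun M => by
    simp only [hE]
    rw [hreal, hScard]
  have hpair : ∀ M M', P.real (E M ∩ E M') =
      p ^ 2 * 2 ^ (Nat.card (LinearMap.ker (M - M')) - 1) := by
    intro M M'
    have h1 : E M ∩ E M' = {ω | ∀ v ∈ S M ∪ S M', v ∈ A ω} := by
      ext ω
      simp only [hE, Set.mem_inter_iff, Set.mem_ofPred_eq, Finset.mem_union, or_imp, forall_and]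
    have h2 := Finset.card_union_add_card_inter (S M) (S M')
    rw [hinter, hScard, hScard] at h2
    have h2' : ((S M ∪ S M').card : ℝ) + ((Nat.card (LinearMap.ker (M - M')) - 1 : ℕ) : ℝ) =
      q + q := by exact_mod_cast h2
    rw [h1, hreal, hp, ← Real.rpow_natCast 2 (Nat.card (LinearMap.ker (M - M')) - 1), sq,
      ← Real.rpow_add (by norm_num), ← Real.rpow_add (by norm_num)]
    congr 1
    linarith
  have hsum : ∑ M, ∑ M', P.real (E M ∩ E M') ≤
      p ^ 2 * (2 ^ (d * e) * ((1 + d * 2 ^ (-x)) * 2 ^ (d * e))) := by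
    have h1 : ∀ M : U →ₗ[ZMod 2] W, ∑ M', P.real (E M ∩ E M') ≤
        p ^ 2 * ((1 + d * 2 ^ (-x)) * 2 ^ (d * e)) := by
      intro M
      simp only [hpair]
      rw [← Finset.mul_sum]
      apply mul_le_mul_of_nonneg_left _ (by positivity)
      -- For fixed `M` the difference `M - M'` runs over every linear map once.
      refine ((Equiv.subLeft M).sum_comp
        (fun N => (2 : ℝ) ^ (Nat.card (LinearMap.ker N) - 1))).trans_le ?_
      exact sum_two_pow_card_ker_le hd he hd0 hx0 hx
    refine (Finset.sum_le_sum fun M _ => h1 M).trans (le_of_eq ?_)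
    rw [Finset.sum_const, Finset.card_univ, hcardN, nsmul_eq_mul]
    push_cast
    ring
  have hsecond := two_sub_le_measureReal_iUnion hmeas hpE hp0.ne'
  have hratio : (∑ M, ∑ M', P.real (E M ∩ E M')) / (Fintype.card (U →ₗ[ZMod 2] W) * p) ^ 2 ≤
      1 + d * 2 ^ (-x) := by
    rw [hcardN, div_le_iff₀ (by positivity)]
    refine hsum.trans (le_of_eq ?_)
    push_cast
    ring
  have hmono : P.real (⋃ M, E M) ≤ P.real {ω | 2 ^ d ≤ (cayleySumGraph (A ω)).cliqueNum} := by
    refine measureReal_mono (fun ω hω => ?_)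
    obtain ⟨M, hM⟩ := Set.mem_iUnion.1 hω
    have : Finite V := Finite.of_equiv _ φ.toEquiv
    have hclique : (cayleySumGraph (A ω)).IsClique
        ((Finset.univ.image fun u => φ (u, M u) : Finset V) : Set V) := by
      intro a ha b hb hab
      simp only [Finset.coe_image, Finset.coe_univ, Set.image_univ, Set.mem_range] at ha hb
      obtain ⟨u, rfl⟩ := ha
      obtain ⟨u', rfl⟩ := hb
      refine ⟨hab, hM _ ?_⟩
      refine Finset.mem_image.2 ⟨u + u', Finset.mem_erase.2 ⟨fun h => hab ?_, Finset.mem_univ _⟩, ?_⟩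
      · rw [show u = u' from by
          exact add_right_cancel (h.trans (ZModModule.add_self u').symm)]
      · rw [← map_add, Prod.mk_add_mk, map_add]
    have h1 := hclique.card_le_cliqueNum
    rwa [Finset.card_image_of_injective _ (hinj M), Finset.card_univ, hcardU] at h1
  linarith

/-- The parameters of the second moment argument for `2 ^ d ≤ n log₂ n < 2 ^ (d + 1)`. -/
theorem eventually_exists_dim_bounds :
    ∀ᶠ n : ℕ in atTop, ∃ d : ℕ, 0 < d ∧ d ≤ n ∧ (1 / 2 : ℝ) * (n * Real.logb 2 n) < 2 ^ d ∧
      (d : ℝ) ≤ 2 * Real.logb 2 n ∧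
      Real.logb 2 n ≤ ((n - d : ℕ) : ℝ) - d - 2 ^ d / d := by
  have hL := tendsto_logb_two_natCast_atTop
  have hLL : Tendsto (fun n : ℕ => Real.logb 2 (Real.logb 2 n)) atTop atTop :=
    (Real.tendsto_logb_atTop (by norm_num)).comp hL
  have hlog2 := Real.log_pos one_lt_two
  have hsmall : ∀ᶠ n : ℕ in atTop, 10 * Real.logb 2 n ^ 2 ≤ n := by
    have h1 := ((isLittleO_log_rpow_atTop (show (0 : ℝ) < 1 / 2 by norm_num)).bound
      (show 0 < Real.log 2 / 4 by positivity)).natCast_atTop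
    filter_upwards [h1, eventually_ge_atTop 1] with n hn hn1
    have hn1' : (1 : ℝ) ≤ n := by exact_mod_cast hn1
    rw [Real.norm_of_nonneg (Real.log_nonneg hn1'), Real.norm_of_nonneg (by positivity),
      ← Real.sqrt_eq_rpow] at hn
    have h2 : Real.logb 2 n ≤ 1 / 4 * √n := by
      rw [Real.logb, div_le_iff₀ hlog2]; linarith
    have h3 : 0 ≤ Real.logb 2 (n : ℝ) := Real.logb_nonneg (by norm_num) hn1'
    have h4 : Real.logb 2 (n : ℝ) ^ 2 ≤ (1 / 4 * √n) ^ 2 := pow_le_pow_left₀ h3 h2 2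
    rw [mul_pow, Real.sq_sqrt (by linarith)] at h4
    linarith
  filter_upwards [hL.eventually_ge_atTop 4, hLL.eventually_ge_atTop 2, hsmall,
    eventually_ge_atTop 1] with n hx hy hs hn1
  have hn1' : (1 : ℝ) ≤ n := by exact_mod_cast hn1
  set x := Real.logb 2 (n : ℝ) with hxdef
  set y := Real.logb 2 x with hydef
  have hx0 : 0 < x := by linarith
  have hyx : y ≤ x := by
    rw [hydef, Real.logb_le_iff_le_rpow (by norm_num) hx0]
    have := one_add_mul_self_le_rpow_one_add (s := 1) (by norm_num) (p := x) (by linarith)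
    norm_num at this
    linarith
  have hnx : 0 < (n : ℝ) * x := by positivity
  have hlognx : Real.logb 2 (n * x) = x + y :=
    Real.logb_mul (by linarith) hx0.ne'
  have h2xy : (2 : ℝ) ^ (x + y) = n * x := by
    rw [← hlognx, Real.rpow_logb (by norm_num) (by norm_num) hnx]
  -- Since `2 ^ (x + y) = n log₂ n`, rounding down loses less than a factor `2`.
  set d := ⌊x + y⌋₊ with hd
  have hdle : (d : ℝ) ≤ x + y := Nat.floor_le (by linarith)
  have hdlt : x + y < d + 1 := Nat.lt_floor_add_one _
  have hd3 : (0 : ℝ) < d := by linarith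
  have hd2x : (d : ℝ) ≤ 2 * x := by linarith
  have hdn : (d : ℝ) ≤ n := by nlinarith
  have hdn' : d ≤ n := by exact_mod_cast hdn
  have h2d : (2 : ℝ) ^ d ≤ n * x := by
    rw [← h2xy, ← Real.rpow_natCast]
    exact Real.rpow_le_rpow_of_exponent_le (by norm_num) hdle
  have h2d' : (n : ℝ) * x < 2 * 2 ^ d := by
    rw [← h2xy, ← pow_succ', ← Real.rpow_natCast]
    apply Real.rpow_lt_rpow_of_exponent_lt (by norm_num)
    push_cast
    exact hdlt
  refine ⟨d, by exact_mod_cast hd3, hdn', by linarith, hd2x, ?_⟩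
  rw [Nat.cast_sub hdn']
  -- As `y = log₂ log₂ n ≥ 2`, even the rounded `d` is at least `x + 1`. So `2 ^ d / d` falls short
  -- of `n` by at least `n / (2 x) ≥ 5 x`, which pays for `2 d ≤ 4 x` and the error parameter `x`.
  have h3 : (2 : ℝ) ^ d / d ≤ n - n / (2 * x) := by
    rw [div_le_iff₀ hd3]
    have h4 : (n - n / (2 * x)) * (x + 1) ≤ (n - n / (2 * x)) * (d : ℝ) := by
      apply mul_le_mul_of_nonneg_left (by linarith)
      rw [sub_nonneg, div_le_iff₀ (by positivity)]
      nlinarith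
    have h5 : (n - n / (2 * x)) * (x + 1) = n * x + (n / 2 - n / (2 * x)) := by field_simp; ring
    have h6 : n / (2 * x) ≤ (n : ℝ) / 2 := by
      apply div_le_div_of_nonneg_left (by linarith) (by norm_num) (by linarith)
    linarith
  have h7 : 5 * x ≤ n / (2 * x) := by
    rw [le_div_iff₀ (by positivity)]
    linarith
  linarith

/-- The clique number of the random Cayley graph is asymptotically almost surely more than
`n log₂ n / 2`. -/
theorem tendsto_measure_lt_cliqueNum {Ω : ℕ → Type*} [∀ n, MeasurableSpace (Ω n)]
    (P : ∀ n, Measure (Ω n)) [∀ n, IsProbabilityMeasure (P n)]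
    (A : ∀ n, Ω n → Set (Fin n → ZMod 2)) (hA : ∀ n, IsRandomHalfSubset (P n) (A n)) :
    Tendsto (fun n : ℕ => P n {ω : Ω n |
      (1 / 2 : ℝ) * (n * Real.logb 2 n) < ((cayleySumGraph (A n ω)).cliqueNum : ℝ)})
      atTop (𝓝 1) := by
  have hlim : Tendsto (fun n : ℕ => ENNReal.ofReal
      (1 - 2 * Real.logb 2 n * 2 ^ (-Real.logb 2 n))) atTop (𝓝 1) := by
    rw [← ENNReal.ofReal_one]
    apply ENNReal.tendsto_ofReal
    have h1 := ((tendsto_mul_two_rpow_neg 1 one_pos).comp tendsto_logb_two_natCast_atTop).const_sub 1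
    rw [sub_zero] at h1
    refine h1.congr fun n => ?_
    simp only [Function.comp_apply]
    rw [sub_eq_add_neg 1 (1 * Real.logb 2 (n : ℝ)), Real.rpow_add (by norm_num), Real.rpow_one]
    simp only [one_mul]
    ring
  refine tendsto_of_tendsto_of_tendsto_of_le_of_le' hlim tendsto_const_nhds ?_
    (Eventually.of_forall fun _ => prob_le_one)
  filter_upwards [eventually_exists_dim_bounds,
    tendsto_logb_two_natCast_atTop.eventually_ge_atTop 0] with n ⟨d, hd0, hdn, hd2, hdx, hx⟩ hL0
  obtain ⟨φ⟩ : Nonempty (((Fin d → ZMod 2) × (Fin (n - d) → ZMod 2)) ≃ₗ[ZMod 2]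
      (Fin n → ZMod 2)) := by
    apply FiniteDimensional.nonempty_linearEquiv_of_finrank_eq
    simp only [Module.finrank_prod, Module.finrank_fin_fun]
    omega
  -- The error parameter is `log₂ n`, so the failure probability is at most `d / n`, hence at most
  -- `2 log₂ n / n`.
  have h1 := (hA n).le_measureReal_two_pow_le_cliqueNum φ (Module.finrank_fin_fun _)
    (Module.finrank_fin_fun _) hd0 hL0 hx
  have h2 : (P n).real {ω | 2 ^ d ≤ (cayleySumGraph (A n ω)).cliqueNum} ≤ (P n).real {ω : Ω n |
      (1 / 2 : ℝ) * (n * Real.logb 2 n) < ((cayleySumGraph (A n ω)).cliqueNum : ℝ)} := by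
    refine measureReal_mono (fun ω hω => ?_)
    have h3 : (2 : ℝ) ^ d ≤ ((cayleySumGraph (A n ω)).cliqueNum : ℝ) := by exact_mod_cast hω
    exact lt_of_lt_of_le hd2 h3
  rw [← ENNReal.ofReal_toReal (measure_ne_top (P n) {ω : Ω n |
      (1 / 2 : ℝ) * (n * Real.logb 2 n) < ((cayleySumGraph (A n ω)).cliqueNum : ℝ)})]
  apply ENNReal.ofReal_le_ofReal
  have h3 : (d : ℝ) * 2 ^ (-Real.logb 2 (n : ℝ)) ≤
      2 * Real.logb 2 n * 2 ^ (-Real.logb 2 (n : ℝ)) :=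
    mul_le_mul_of_nonneg_right hdx (by positivity)
  rw [measureReal_def] at h1 h2
  rw [measureReal_def] at h2
  linarith

end LowerBound

/-! ### Combination of the two bounds. -/

theorem theorem1 {Ω : ℕ → Type*} [∀ n, MeasurableSpace (Ω n)]
    (P : ∀ n, Measure (Ω n)) [∀ n, IsProbabilityMeasure (P n)]
    (A : ∀ n, Ω n → Set (Fin n → ZMod 2))
    (hA : ∀ n, IsRandomHalfSubset (P n) (A n))
    (ε : ℝ) (hε : 0 < ε) :
    Tendsto
      (fun n : ℕ => P n {ω : Ω n |
        (1 / 2 : ℝ) * (n * Real.logb 2 n) < ((cayleySumGraph (A n ω)).cliqueNum : ℝ) ∧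
        ((cayleySumGraph (A n ω)).cliqueNum : ℝ) < (1 + ε) * (n * Real.logb 2 n)})
      atTop (𝓝 1) := by
  have hlow := tendsto_measure_lt_cliqueNum P A hA
  -- The upper bound needs `ε ≤ 1`. Passing to `min ε 1` only lowers the threshold once `log₂ n ≥
  -- 0`, so the event to be excluded only grows.
  have hup := tendsto_measure_le_cliqueNum P A hA (ε := min ε 1) (by positivity) (min_le_right _ _)
  have hlim := ENNReal.Tendsto.sub hlow hup (Or.inl ENNReal.one_ne_top)
  rw [tsub_zero] at hlim
  refine tendsto_of_tendsto_of_tendsto_of_le_of_le' hlim tendsto_const_nhds ?_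
    (Eventually.of_forall fun _ => prob_le_one)
  filter_upwards [tendsto_logb_two_natCast_atTop.eventually_ge_atTop 0] with n hn
  rw [tsub_le_iff_right]
  refine (measure_mono fun ω hω => ?_).trans (measure_union_le _ _)
  by_cases h : ((cayleySumGraph (A n ω)).cliqueNum : ℝ) < (1 + ε) * (n * Real.logb 2 n)
  · exact Or.inl ⟨hω, h⟩
  · refine Or.inr (le_trans ?_ (not_lt.1 h))
    exact mul_le_mul_of_nonneg_right (by linarith [min_le_left ε 1])
      (mul_nonneg (Nat.cast_nonneg _) hn)
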